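/- Let $k$ be a field of arbitrary characteristic, $V$ a vector space over $k$ of finite dimension $n$, and $G$ a finite abelian subgroup of $\mathrm{GL}(V)$. Let $k[V]$ be the symmetric algebra on the dual space $V^*$, with its standard grading and with the induced action of $G$ by algebra automorphisms, and let $k[V]^G$ be the ring of invariants. A linear map $\tau\colon V\to V$ is called a pseudo-reflection if its fixed-point space $\{v\in V : \tau(v)=v\}$ has codimension one in $V$. Then the action of $G$ is coregular, that is, $k[V]^G$ is generated as a $k$-algebra by $n$ algebraically independent homogeneous invariants, if and only if both of the following hold: $G$ is generated by pseudo-reflections, and the direct summand property holds, that is, there is a surjective $k[V]^G$-linear map $\pi\colon k[V]\to k[V]^G$ which respects the gradings (it maps homogeneous elements of degree $d$ to homogeneous elements of degree $d$, for every $d\ge 0$). -/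

import Mathlib

namespace AbelianCoregular

variable (k : Type*) [Field k] (V : Type*) [AddCommGroup V] [Module k V]

/-- The coordinate ring `k[V]`: the symmetric algebra on the dual space `V*`. -/
abbrev CoordRing : Type _ := SymmetricAlgebra k (Module.Dual k V)

/-- The homogeneous component of degree `d` of `k[V]`: the `k`-span of all products of
`d` linear forms (for `d = 0` this is the image of `k`). -/
noncomputable def homogeneousPart (d : ℕ) : Submodule k (CoordRing k V) :=
  LinearMap.range (SymmetricAlgebra.ι k (Module.Dual k V)) ^ d

/-- The left action of the group of linear automorphisms of `V` on `k[V]` by algebra maps. On a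
linear form `x` it is given by `(σ x)(v) = x (σ⁻¹ v)`. -/
noncomputable def coordAction : (V ≃ₗ[k] V) →* (CoordRing k V →ₐ[k] CoordRing k V) where
  toFun σ := SymmetricAlgebra.lift
    (SymmetricAlgebra.ι k (Module.Dual k V) ∘ₗ (σ.symm : V →ₗ[k] V).dualMap)
  map_one' := by
    apply SymmetricAlgebra.algHom_ext
    refine LinearMap.ext fun x => ?_
    exact SymmetricAlgebra.lift_ι_apply _ x
  map_mul' σ τ := by
    apply SymmetricAlgebra.algHom_ext
    refine LinearMap.ext fun x => ?_
    change SymmetricAlgebra.lift _ (SymmetricAlgebra.ι k _ x) =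
      SymmetricAlgebra.lift _ (SymmetricAlgebra.lift _ (SymmetricAlgebra.ι k _ x))
    simp only [SymmetricAlgebra.lift_ι_apply, LinearMap.comp_apply]
    rfl

variable {k V}

/-- The invariant ring `k[V]^G`. -/
noncomputable def invariants (G : Subgroup (V ≃ₗ[k] V)) : Subalgebra k (CoordRing k V) where
  carrier := {f | ∀ σ ∈ G, coordAction k V σ f = f}
  mul_mem' ha hb σ hσ := by rw [map_mul, ha σ hσ, hb σ hσ]
  add_mem' ha hb σ hσ := by rw [map_add, ha σ hσ, hb σ hσ]
  algebraMap_mem' r σ _ := AlgHom.commutes _ r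

/-- A pseudo-reflection: its fixed-point space has codimension one. -/
def IsPseudoReflection (τ : V →ₗ[k] V) : Prop :=
  Module.finrank k (V ⧸ τ.fixedSubmodule) = 1

/-- `G` is generated by the pseudo-reflections that it contains. -/
def IsPseudoReflectionGroup (G : Subgroup (V ≃ₗ[k] V)) : Prop :=
  Subgroup.closure {τ : V ≃ₗ[k] V | τ ∈ G ∧ IsPseudoReflection (τ : V →ₗ[k] V)} = G

/-- The action of `G` is coregular: `k[V]^G` is generated as a `k`-algebra by `dim V`
algebraically independent homogeneous invariants. -/
def IsCoregular (G : Subgroup (V ≃ₗ[k] V)) : Prop :=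
  ∃ f : Fin (Module.finrank k V) → CoordRing k V,
    (∀ i, f i ∈ invariants G) ∧
    (∀ i, ∃ d : ℕ, f i ∈ homogeneousPart k V d) ∧
    AlgebraicIndependent k f ∧
    Algebra.adjoin k (Set.range f) = invariants G

/-- The direct summand property: there is a surjective `k[V]^G`-linear map `k[V] → k[V]^G`
respecting the gradings. -/
def DirectSummandProperty (G : Subgroup (V ≃ₗ[k] V)) : Prop :=
  ∃ π : CoordRing k V →ₗ[invariants G] invariants G,
    Function.Surjective π ∧
    ∀ (d : ℕ) (f : CoordRing k V), f ∈ homogeneousPart k V d →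
      (π f : CoordRing k V) ∈ homogeneousPart k V d

end AbelianCoregular

open MvPolynomial

namespace MvPolynomial

/-! ### Graded subalgebras and lifting of homogeneous generators -/

section Graded

variable {k σ τ : Type*} [Field k]

/-! Everything is transported to polynomials in a basis of linear forms.

Sufficiency. Commuting reflections `x ↦ x + φ x • l` constrain each other so strongly that `V*` has
a basis (`exists_adapted_basis`) of eigenvectors, fixed forms, and forms `y` moved only by
combinations of the fixed forms, where moreover each eigenvector can be scaled independently of the
rest of the basis. If `c` is the least positive exponent trivialising the character of an
eigenvector `x`, then `x ^ c` is invariant, and every monomial of an invariant contains `x` with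
exponent `0` or at least `c`. So an invariant that vanishes when the eigenvectors and fixed forms
are set to zero lies in the ideal of `k[V]` generated by these powers and the fixed forms; the
retraction onto the invariants replaces the coefficients by invariant ones. It remains to generate
the image of the invariants in `k[y₁, …, y_u]` by `u` forms. The group commutes with translations in
the `y`-directions, so the image is closed under Hasse derivatives, and this suffices
(`exists_generators_of_isTranslationStable`): a linear form in the image can be divided out, while
without linear forms all first derivatives vanish, so that the image is `k` or, in characteristic
`p`, consists of polynomials in the `p`-th powers of the variables and one descends along `expand
p`. The number of generators equals the transcendence degree, whence their independence.

Necessity. Basic invariants are a homogeneous system of parameters, hence a regular sequence, so `S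
= k[V]` is free over the invariants with a basis of monomials containing `1`
(`exists_basis_monomial`). The coordinate at `1` is a graded retraction. For the reflections, let `A
⊆ S^G` be the `S`-span of the orbit vectors `(g s)_g`; by freeness it has an `S`-basis of orbit
vectors. Let `H` be generated by the reflections. Two elements of `G` congruent modulo a prime of
`S` differ by a reflection, so the indicator of `H` lies in `A` locally at each prime, and therefore
globally (`mem_adjoin_of_forall_prime`). But the constant terms of the coordinates of a vector in
`A` all agree, so the indicator is constant and `H = G`. -/

theorem homogeneousComponent_add_mul {f : MvPolynomial σ k} {d : ℕ} (hf : f.IsHomogeneous d)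
    (g : MvPolynomial σ k) (n : ℕ) :
    homogeneousComponent (n + d) (g * f) = homogeneousComponent n g * f := by
  conv_lhs => rw [← sum_homogeneousComponent g, Finset.sum_mul, map_sum]
  have h : ∀ i, homogeneousComponent (n + d) (homogeneousComponent i g * f) =
      if i = n then homogeneousComponent i g * f else 0 := by
    intro i
    rw [homogeneousComponent_of_mem ((homogeneousComponent_isHomogeneous i g).mul hf)]
    simp [eq_comm]
  simp only [h, Finset.sum_ite_eq', Finset.mem_range]
  split_ifs with hn
  · rfl
  · rw [homogeneousComponent_eq_zero _ _ (by omega), zero_mul]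

theorem homogeneousComponent_mul_of_lt {f : MvPolynomial σ k} {d : ℕ} (hf : f.IsHomogeneous d)
    (g : MvPolynomial σ k) {n : ℕ} (hn : n < d) :
    homogeneousComponent n (g * f) = 0 := by
  conv_lhs => rw [← sum_homogeneousComponent g, Finset.sum_mul, map_sum]
  refine Finset.sum_eq_zero fun i _ => ?_
  rw [homogeneousComponent_of_mem ((homogeneousComponent_isHomogeneous i g).mul hf),
    if_neg (by omega)]

/-- A subalgebra is graded if it contains the homogeneous components of its elements. -/
def IsGraded (A : Subalgebra k (MvPolynomial σ k)) : Prop :=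
  ∀ a ∈ A, ∀ d, homogeneousComponent d a ∈ A

theorem mem_of_homogeneousComponent_mem {S : Type*} [SetLike S (MvPolynomial σ k)]
    [AddSubmonoidClass S (MvPolynomial σ k)] {A : S} {a : MvPolynomial σ k}
    (h : ∀ d, homogeneousComponent d a ∈ A) : a ∈ A := by
  rw [← sum_homogeneousComponent a]
  exact sum_mem fun d _ => h d

theorem isGraded_adjoin {s : Set (MvPolynomial σ k)} (hs : ∀ f ∈ s, ∃ d, f.IsHomogeneous d) :
    IsGraded (Algebra.adjoin k s) := by
  intro a ha
  induction ha using Algebra.adjoin_induction with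
  | mem x hx =>
    intro d
    obtain ⟨e, he⟩ := hs x hx
    rw [homogeneousComponent_of_mem he]
    split_ifs
    · exact Algebra.subset_adjoin hx
    · exact zero_mem _
  | algebraMap r =>
    intro d
    rw [algebraMap_eq, homogeneousComponent_of_mem (isHomogeneous_C σ r)]
    split_ifs
    · exact Subalgebra.algebraMap_mem _ r
    · exact zero_mem _
  | add x y _ _ hx hy => intro d; rw [map_add]; exact add_mem (hx d) (hy d)
  | mul x y _ _ hx hy =>
    intro d
    rw [← sum_homogeneousComponent y, Finset.mul_sum, map_sum]
    refine sum_mem fun i _ => ?_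
    rcases lt_or_ge d i with h | h
    · rw [homogeneousComponent_mul_of_lt (homogeneousComponent_isHomogeneous i y) x h]
      exact zero_mem _
    · obtain ⟨e, rfl⟩ := Nat.exists_eq_add_of_le' h
      rw [homogeneousComponent_add_mul (homogeneousComponent_isHomogeneous i y)]
      exact mul_mem (hx e) (hy i)

theorem map_homogeneousComponent {F : Type*} [FunLike F (MvPolynomial σ k) (MvPolynomial τ k)]
    [AddMonoidHomClass F (MvPolynomial σ k) (MvPolynomial τ k)] {ρ : F}
    (hρ : ∀ d f, f.IsHomogeneous d → (ρ f).IsHomogeneous d) (f : MvPolynomial σ k) (d : ℕ) :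
    homogeneousComponent d (ρ f) = ρ (homogeneousComponent d f) := by
  conv_lhs => rw [← sum_homogeneousComponent f, map_sum, map_sum]
  have h : ∀ i, homogeneousComponent d (ρ (homogeneousComponent i f)) =
      if i = d then ρ (homogeneousComponent i f) else 0 := by
    intro i
    rw [homogeneousComponent_of_mem (hρ _ _ (homogeneousComponent_isHomogeneous i f))]
    simp [eq_comm]
  simp only [h, Finset.sum_ite_eq', Finset.mem_range]
  split_ifs with hn
  · rfl
  · rw [homogeneousComponent_eq_zero _ _ (by omega), map_zero]

theorem IsGraded.map {A : Subalgebra k (MvPolynomial σ k)} (hA : IsGraded A)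
    {ρ : MvPolynomial σ k →ₐ[k] MvPolynomial τ k}
    (hρ : ∀ d f, f.IsHomogeneous d → (ρ f).IsHomogeneous d) : IsGraded (A.map ρ) := by
  rintro _ ⟨a, ha, rfl⟩ d
  exact ⟨homogeneousComponent d a, hA a ha d, (map_homogeneousComponent hρ a d).symm⟩

theorem isHomogeneous_aeval_of_linear {g : σ → MvPolynomial τ k}
    (hg : ∀ i, (g i).IsHomogeneous 1) (d : ℕ) (f : MvPolynomial σ k) (hf : f.IsHomogeneous d) :
    (aeval g f).IsHomogeneous d := by
  simpa using IsHomogeneous.aeval hf g hg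

/-- Homogeneous generators lift along a graded map whose kernel on `R` is generated by
homogeneous elements of positive degree. -/
theorem exists_homogeneous_generators_of_map {α β : Type*} [Fintype α]
    {R : Subalgebra k (MvPolynomial σ k)} (hR : IsGraded R)
    {ρ : MvPolynomial σ k →ₐ[k] MvPolynomial τ k}
    (hρ : ∀ d f, f.IsHomogeneous d → (ρ f).IsHomogeneous d)
    {h : α → MvPolynomial σ k} {e : α → ℕ} (he : ∀ i, 0 < e i)
    (hh : ∀ i, (h i).IsHomogeneous (e i)) (hhR : ∀ i, h i ∈ R)
    (hker : ∀ f ∈ R, ρ f = 0 → ∃ r : α → MvPolynomial σ k, (∀ i, r i ∈ R) ∧ f = ∑ i, r i * h i)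
    {g : β → MvPolynomial τ k} (hg : ∀ j, ∃ d, (g j).IsHomogeneous d)
    (hgR : Algebra.adjoin k (Set.range g) = R.map ρ) :
    ∃ G : α ⊕ β → MvPolynomial σ k,
      (∀ x, ∃ d, (G x).IsHomogeneous d) ∧ Algebra.adjoin k (Set.range G) = R := by
  choose d hd using hg
  have hex : ∀ j, ∃ f ∈ R, f.IsHomogeneous (d j) ∧ ρ f = g j := by
    intro j
    have : g j ∈ R.map ρ := hgR ▸ Algebra.subset_adjoin ⟨j, rfl⟩
    obtain ⟨f, hf, hfg⟩ := this
    refine ⟨homogeneousComponent (d j) f, hR f hf _, homogeneousComponent_isHomogeneous _ _, ?_⟩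
    rw [← map_homogeneousComponent hρ]
    rw [show ρ f = g j from hfg]
    exact homogeneousComponent_eq_self (hd j)
  choose L hLR hLd hLg using hex
  have hG : ∀ x, ∃ d, (Sum.elim h L x).IsHomogeneous d := by
    rintro (i | j)
    · exact ⟨_, hh i⟩
    · exact ⟨_, hLd j⟩
  refine ⟨Sum.elim h L, hG, le_antisymm ?_ ?_⟩
  · rw [Algebra.adjoin_le_iff]
    rintro _ ⟨i | j, rfl⟩
    · exact hhR i
    · exact hLR j
  have key : ∀ n f, f ∈ R → f.IsHomogeneous n →
      f ∈ Algebra.adjoin k (Set.range (Sum.elim h L)) := by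
    intro n
    induction n using Nat.strong_induction_on with
    | _ n ih =>
      intro f hf hfn
      have h1 : ρ f ∈ (Algebra.adjoin k (Set.range L)).map ρ := by
        rw [AlgHom.map_adjoin, ← Set.range_comp]
        have : (ρ ∘ L) = g := _root_.funext hLg
        rw [this, hgR]
        exact ⟨f, hf, rfl⟩
      obtain ⟨q, hq, hqf⟩ := h1
      have hqf' : ρ q = ρ f := hqf
      have hqR : q ∈ R := by
        refine (Algebra.adjoin_le_iff.2 ?_ : Algebra.adjoin k (Set.range L) ≤ R) hq
        rintro _ ⟨j, rfl⟩
        exact hLR j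
      have hq' : q ∈ Algebra.adjoin k (Set.range (Sum.elim h L)) := by
        refine Algebra.adjoin_mono ?_ hq
        rintro _ ⟨j, rfl⟩
        exact ⟨Sum.inr j, rfl⟩
      obtain ⟨r, hrR, hr⟩ := hker (f - q) (sub_mem hf hqR) (by rw [map_sub, hqf', sub_self])
      -- Neither `q` nor the `r i` need be homogeneous, so only their relevant components are kept.
      -- As `e i > 0`, the components of `r i` that occur have degree below `n`.
      have h2 : f = homogeneousComponent n q + ∑ i, homogeneousComponent n (r i * h i) := by
        rw [← map_sum, ← hr, map_sub, homogeneousComponent_eq_self hfn]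
        ring
      rw [h2]
      refine add_mem (isGraded_adjoin ?_ q hq' n) (sum_mem fun i _ => ?_)
      · rintro _ ⟨x, rfl⟩
        exact hG x
      · rcases lt_or_ge n (e i) with hlt | hge
        · rw [homogeneousComponent_mul_of_lt (hh i) _ hlt]
          exact zero_mem _
        · obtain ⟨m, rfl⟩ := Nat.exists_eq_add_of_le' hge
          rw [homogeneousComponent_add_mul (hh i)]
          refine mul_mem (ih m (by have := he i; omega) _ (hR _ (hrR i) m)
            (homogeneousComponent_isHomogeneous _ _)) (Algebra.subset_adjoin ⟨Sum.inl i, rfl⟩)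
  intro f hf
  exact mem_of_homogeneousComponent_mem fun n =>
    key n _ (hR f hf n) (homogeneousComponent_isHomogeneous n f)

end Graded

/-! ### Translations and Hasse derivatives -/

section Translation

variable {k σ τ : Type*} [Field k]

/-- Translation by the multiple `t • v` of a vector `v`, as a polynomial in `t`. -/
noncomputable def translate (v : τ → k) :
    MvPolynomial τ k →ₐ[k] Polynomial (MvPolynomial τ k) :=
  aeval fun j => Polynomial.C (X j) + Polynomial.C (C (v j)) * Polynomial.X

/-- Stability of a subalgebra under the coefficients of a translation. -/
def IsTranslationStable (A : Subalgebra k (MvPolynomial τ k)) (v : τ → k) : Prop :=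
  ∀ a ∈ A, ∀ n, (translate v a).coeff n ∈ A

theorem translate_X (v : τ → k) (j : τ) :
    translate v (X j) = Polynomial.C (X j) + Polynomial.C (C (v j)) * Polynomial.X := by
  simp [translate]

theorem translate_C (v : τ → k) (r : k) : translate v (C r) = Polynomial.C (C r) := by
  simp [translate, Polynomial.algebraMap_apply, algebraMap_eq]

theorem coeff_zero_translate (v : τ → k) (a : MvPolynomial τ k) :
    (translate v a).coeff 0 = a := by
  have h : ((Polynomial.aeval (0 : MvPolynomial τ k)).restrictScalars k).comp (translate v) =
      AlgHom.id k _ := by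
    ext j : 1
    simp [translate_X]
  have := DFunLike.congr_fun h a
  simpa [Polynomial.coeff_zero_eq_aeval_zero] using this

theorem coeff_mul_C_add_C_mul_X {R : Type*} [CommRing R] (q : Polynomial R) (x c : R) (n : ℕ) :
    (q * (Polynomial.C x + Polynomial.C c * Polynomial.X)).coeff (n + 1) =
      q.coeff (n + 1) * x + q.coeff n * c := by
  rw [mul_add, Polynomial.coeff_add, Polynomial.coeff_mul_C, ← mul_assoc, Polynomial.coeff_mul_X,
    Polynomial.coeff_mul_C]

/-- The coefficients of a translate are the Hasse derivatives along `v`; unlike iterated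
derivatives, the higher ones still detect `p`-th powers in characteristic `p`. -/
theorem coeff_one_translate [DecidableEq τ] (i : τ) (a : MvPolynomial τ k) :
    (translate (Pi.single i 1) a).coeff 1 = pderiv i a := by
  induction a using MvPolynomial.induction_on with
  | C r => simp
  | add p q hp hq => simp [hp, hq]
  | mul_X p j hp =>
    rw [map_mul, translate_X, coeff_mul_C_add_C_mul_X, hp, coeff_zero_translate,
      Derivation.leibniz, pderiv_X, smul_eq_mul, smul_eq_mul]
    by_cases h : j = i
    · subst h; simp; ring
    · simp [h, mul_comm]

theorem coeff_translate_pderiv (v : τ → k) (i : τ) (a : MvPolynomial τ k) (n : ℕ) :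
    (translate v (pderiv i a)).coeff n = pderiv i ((translate v a).coeff n) := by
  classical
  induction a using MvPolynomial.induction_on generalizing n with
  | C r => simp [Polynomial.coeff_C]; split_ifs <;> simp
  | add p q hp hq => simp [hp, hq]
  | mul_X p j hp =>
    have hc : ∀ m, (translate v (p * pderiv i (X j))).coeff m =
        (translate v p).coeff m * pderiv i (X j) := by
      intro m
      by_cases h : j = i
      · subst h; simp
      · simp [pderiv_X, h]
    rw [Derivation.leibniz, smul_eq_mul, smul_eq_mul, map_add, Polynomial.coeff_add, hc,
      mul_comm (X j), map_mul, map_mul, translate_X]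
    cases n with
    | zero =>
      simp only [mul_add, Polynomial.coeff_add, Polynomial.mul_coeff_zero, Polynomial.coeff_C_zero,
        Polynomial.coeff_X_zero, mul_zero, add_zero, hp, Derivation.leibniz, smul_eq_mul]
      ring
    | succ n =>
      rw [coeff_mul_C_add_C_mul_X, coeff_mul_C_add_C_mul_X, hp, hp, map_add, Derivation.leibniz,
        Derivation.leibniz, pderiv_C, smul_eq_mul, smul_eq_mul, smul_eq_mul, smul_eq_mul]
      ring

/-- Homogeneity of total degree `d` of a polynomial in one further variable of degree one. -/
def IsTotallyHomogeneous (q : Polynomial (MvPolynomial τ k)) (d : ℕ) : Prop :=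
  ∀ n, (∀ m, m + n = d → (q.coeff n).IsHomogeneous m) ∧ (d < n → q.coeff n = 0)

theorem IsTotallyHomogeneous.mul {p q : Polynomial (MvPolynomial τ k)} {d e : ℕ}
    (hp : IsTotallyHomogeneous p d) (hq : IsTotallyHomogeneous q e) :
    IsTotallyHomogeneous (p * q) (d + e) := by
  intro n
  rw [Polynomial.coeff_mul]
  constructor
  · intro m hm
    refine IsHomogeneous.sum _ _ _ fun x hx => ?_
    rw [Finset.HasAntidiagonal.mem_antidiagonal] at hx
    by_cases h1 : d < x.1
    · rw [(hp x.1).2 h1, zero_mul]; exact isHomogeneous_zero _ _ _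
    by_cases h2 : e < x.2
    · rw [(hq x.2).2 h2, mul_zero]; exact isHomogeneous_zero _ _ _
    have := ((hp x.1).1 (d - x.1) (by omega)).mul ((hq x.2).1 (e - x.2) (by omega))
    rwa [show d - x.1 + (e - x.2) = m by omega] at this
  · intro h
    refine Finset.sum_eq_zero fun x hx => ?_
    rw [Finset.HasAntidiagonal.mem_antidiagonal] at hx
    by_cases h1 : d < x.1
    · rw [(hp x.1).2 h1, zero_mul]
    · rw [(hq x.2).2 (by omega), mul_zero]

theorem isTotallyHomogeneous_C (r : k) :
    IsTotallyHomogeneous (Polynomial.C (C r) : Polynomial (MvPolynomial τ k)) 0 := by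
  intro n
  rw [Polynomial.coeff_C]
  refine ⟨fun m hm => ?_, fun h => if_neg (by omega)⟩
  rw [if_pos (by omega), show m = 0 by omega]
  exact isHomogeneous_C _ _

theorem isTotallyHomogeneous_translate_X (v : τ → k) (j : τ) :
    IsTotallyHomogeneous (translate v (X j)) 1 := by
  rw [translate_X]
  intro n
  rcases n with _ | _ | n
  · refine ⟨fun m hm => ?_, fun h => by omega⟩
    obtain rfl : m = 1 := by omega
    simpa using isHomogeneous_X k j
  · refine ⟨fun m hm => ?_, fun h => by omega⟩
    obtain rfl : m = 0 := by omega
    simpa [Polynomial.coeff_C] using isHomogeneous_C τ (v j)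
  · refine ⟨fun m hm => by omega, fun h => ?_⟩
    simp

theorem isTotallyHomogeneous_translate (v : τ → k) {a : MvPolynomial τ k} {d : ℕ}
    (ha : a.IsHomogeneous d) : IsTotallyHomogeneous (translate v a) d := by
  have hpow : ∀ j e, IsTotallyHomogeneous (translate v (X j) ^ e) e := by
    intro j e
    induction e with
    | zero => simpa using isTotallyHomogeneous_C (1 : k)
    | succ e ih => rw [pow_succ]; exact ih.mul (isTotallyHomogeneous_translate_X v j)
  have hmon : ∀ γ : τ →₀ ℕ, IsTotallyHomogeneous (translate v (monomial γ 1)) γ.degree := by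
    intro γ
    rw [monomial_eq, C_1, one_mul, Finsupp.prod, map_prod, Finsupp.degree_apply]
    simp only [map_pow]
    induction γ.support using Finset.cons_induction with
    | empty => simpa using isTotallyHomogeneous_C (1 : k)
    | cons i s hi ih => rw [Finset.prod_cons, Finset.sum_cons]; exact (hpow i _).mul ih
  intro n
  conv => arg 1; rw [a.as_sum, map_sum, Polynomial.finsetSum_coeff]
  conv => arg 2; rw [a.as_sum, map_sum, Polynomial.finsetSum_coeff]
  have hγ : ∀ γ ∈ a.support, IsTotallyHomogeneous (translate v (monomial γ (a.coeff γ))) d := by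
    intro γ hγ
    have h1 : γ.degree = d := by
      by_contra h
      exact (mem_support_iff.1 hγ) (ha.coeff_eq_zero h)
    have := (isTotallyHomogeneous_C (τ := τ) (a.coeff γ)).mul (hmon γ)
    rwa [zero_add, h1, ← translate_C v, ← map_mul, C_mul_monomial, mul_one] at this
  exact ⟨fun m hm => IsHomogeneous.sum _ _ _ fun γ h => (hγ γ h n).1 m hm,
    fun h => Finset.sum_eq_zero fun γ h' => (hγ γ h' n).2 h⟩

/-- Setting `X i` to `0` and then the translation parameter to `X i` undoes the translation, in any
characteristic. On a translate that is constant in the parameter, this just sets `X i` to `0`. -/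
theorem aeval_eq_of_translate_eq_C [DecidableEq τ] {i : τ} {b : MvPolynomial τ k}
    (hb : translate (Pi.single i 1) b = Polynomial.C b) :
    aeval (fun j => if j = i then (0 : MvPolynomial τ k) else X j) b = b := by
  let φ : Polynomial (MvPolynomial τ k) →+* MvPolynomial τ k :=
    Polynomial.eval₂RingHom
      (aeval (R := k) fun j => if j = i then (0 : MvPolynomial τ k) else X j).toRingHom (X i)
  have h : φ.comp (translate (Pi.single i (1 : k))).toRingHom = RingHom.id _ := by
    refine MvPolynomial.ringHom_ext (fun r => ?_) (fun j => ?_)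
    · simp [φ]
    · by_cases hj : j = i
      · subst hj; simp [φ, translate_X]
      · simp [φ, translate_X, hj]
  have h2 := DFunLike.congr_fun h b
  simp only [RingHom.comp_apply, AlgHom.toRingHom_eq_coe, RingHom.coe_coe, hb,
    RingHom.id_apply] at h2
  simpa [φ] using h2

theorem eq_C_of_forall_translate_eq_C [Finite τ] [DecidableEq τ] {b : MvPolynomial τ k}
    (hb : ∀ i, translate (Pi.single i 1) b = Polynomial.C b) : b = C (constantCoeff b) := by
  cases nonempty_fintype τ
  have h : ∀ s : Finset τ,
      aeval (fun j => if j ∈ s then (0 : MvPolynomial τ k) else X j) b = b := by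
    intro s
    induction s using Finset.induction_on with
    | empty => simp
    | insert i s hi ih =>
      conv_rhs => rw [← ih, ← aeval_eq_of_translate_eq_C (hb i), ← AlgHom.comp_apply]
      congr 1
      ext j : 1
      by_cases h1 : j = i
      · subst h1; simp
      · by_cases h2 : j ∈ s <;> simp [h1, h2]
  have := h Finset.univ
  simp only [Finset.mem_univ, if_true] at this
  conv_lhs => rw [← this]
  rw [← algebraMap_eq, ← aeval_zero']

/-- A translation stable graded subalgebra without linear forms is killed by all partial
derivatives. -/
theorem pderiv_eq_zero_of_isTranslationStable [Finite τ] [DecidableEq τ]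
    {A : Subalgebra k (MvPolynomial τ k)} (hA : IsGraded A)
    (hst : ∀ i, IsTranslationStable A (Pi.single i 1))
    (hlin : ∀ a ∈ A, a.IsHomogeneous 1 → a = 0) (i : τ) : ∀ a ∈ A, pderiv i a = 0 := by
  have key : ∀ d, ∀ a ∈ A, a.IsHomogeneous d → ∀ i, pderiv i a = 0 := by
    intro d
    induction d using Nat.strong_induction_on with
    | _ d ih =>
      intro a ha had i
      rcases Nat.lt_or_ge d 2 with hd | hd
      · interval_cases d
        · rw [← totalDegree_zero_iff_isHomogeneous, totalDegree_eq_zero_iff_eq_C] at had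
          rw [had, pderiv_C]
        · rw [hlin a ha had, map_zero]
      -- The higher coefficients are `i`-th derivatives of elements of `A` of degree below `d`,
      -- which vanish by induction. So the derivative of `a` is a constant, yet homogeneous of
      -- degree `d - 1 > 0`.
      have hb : ∀ j, translate (Pi.single j 1) (pderiv i a) = Polynomial.C (pderiv i a) := by
        intro j
        ext1 n
        rw [Polynomial.coeff_C]
        split_ifs with hn
        · rw [hn, coeff_zero_translate]
        rw [coeff_translate_pderiv]
        have hT := isTotallyHomogeneous_translate (Pi.single j 1) had n
        rcases lt_or_ge d n with h | h
        · rw [hT.2 h, map_zero]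
        · exact ih (d - n) (by omega) _ (hst j a ha n) (hT.1 _ (by omega)) i
      have h1 : (pderiv i a).IsHomogeneous (d - 1) := by
        rw [← coeff_one_translate i a]
        exact (isTotallyHomogeneous_translate _ had 1).1 _ (by omega)
      rw [eq_C_of_forall_translate_eq_C hb]
      rw [constantCoeff_eq, h1.coeff_eq_zero (by rw [map_zero]; omega), C_0]
  intro a ha
  rw [← sum_homogeneousComponent a, map_sum]
  exact Finset.sum_eq_zero fun d _ => key d _ (hA a ha d) (homogeneousComponent_isHomogeneous _ _) i

end Translation

/-! ### Operations preserving translation stability -/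

section Translation

variable {k σ τ : Type*} [Field k]

theorem IsTranslationStable.add {A : Subalgebra k (MvPolynomial τ k)} {v w : τ → k}
    (hv : IsTranslationStable A v) (hw : IsTranslationStable A w) :
    IsTranslationStable A (v + w) := by
  intro a ha n
  have h : (Polynomial.eval₂RingHom (translate w).toRingHom Polynomial.X).comp
      (translate v).toRingHom = (translate (v + w)).toRingHom := by
    refine MvPolynomial.ringHom_ext (fun r => ?_) (fun j => ?_)
    · simp
    · simp [translate_X]; ring
  have h2 := DFunLike.congr_fun h a
  simp only [RingHom.comp_apply, AlgHom.toRingHom_eq_coe, RingHom.coe_coe,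
    Polynomial.coe_eval₂RingHom, Polynomial.eval₂_eq_sum_range] at h2
  rw [← h2, Polynomial.finsetSum_coeff]
  refine sum_mem fun i _ => ?_
  rw [Polynomial.coeff_mul_X_pow']
  split_ifs
  · exact hw _ (hv a ha i) _
  · exact zero_mem _

theorem IsTranslationStable.smul {A : Subalgebra k (MvPolynomial τ k)} {v : τ → k}
    (hv : IsTranslationStable A v) (c : k) : IsTranslationStable A (c • v) := by
  intro a ha n
  have h : (Polynomial.compRingHom (Polynomial.C (C c) * Polynomial.X)).comp
      (translate v).toRingHom = (translate (c • v)).toRingHom := by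
    refine MvPolynomial.ringHom_ext (fun r => ?_) (fun j => ?_)
    · simp
    · simp [translate_X]; ring
  have h2 := DFunLike.congr_fun h a
  simp only [RingHom.comp_apply, AlgHom.toRingHom_eq_coe, RingHom.coe_coe,
    Polynomial.coe_compRingHom_apply] at h2
  rw [← h2, Polynomial.comp_C_mul_X_coeff]
  exact mul_mem (hv a ha n) (pow_mem (A.algebraMap_mem c) n)

/-- Needed because descent along `expand p` directly gives stability only in the coordinate
directions, whose entries are fixed by Frobenius. -/
theorem isTranslationStable_of_single [Finite τ] [DecidableEq τ]
    {A : Subalgebra k (MvPolynomial τ k)}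
    (h : ∀ i, IsTranslationStable A (Pi.single i 1)) (v : τ → k) : IsTranslationStable A v := by
  cases nonempty_fintype τ
  have h0 : IsTranslationStable A 0 := by
    intro a ha n
    have : translate (0 : τ → k) = Polynomial.CAlgHom (R := k) (A := MvPolynomial τ k) := by
      ext j : 1
      simp [translate_X]
    rw [this, Polynomial.CAlgHom_apply, Polynomial.coeff_C]
    split_ifs
    exacts [ha, zero_mem _]
  have hs : ∀ s : Finset τ, IsTranslationStable A (∑ i ∈ s, v i • Pi.single i (1 : k)) := by
    intro s
    induction s using Finset.induction_on with
    | empty => simpa using h0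
    | insert i s hi ih => rw [Finset.sum_insert hi]; exact ((h i).smul _).add ih
  convert hs Finset.univ
  ext j
  simp [Finset.sum_apply, Pi.single_apply]

/-- If a linear form `l` in a translation stable subalgebra is translated to `l + t`, then
divisibility by `l` can be tested in the ambient polynomial ring. -/
theorem IsTranslationStable.mem_of_mul_mem {A : Subalgebra k (MvPolynomial τ k)} {v : τ → k}
    (hv : IsTranslationStable A v) {l b : MvPolynomial τ k} (hl : l ∈ A)
    (hvl : translate v l = Polynomial.X + Polynomial.C l) (hlb : l * b ∈ A) : b ∈ A := by
  have h1 : translate v (l * b) ∈ Polynomial.lifts A.val.toRingHom := by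
    rw [Polynomial.lifts_iff_coeff_lifts]
    exact fun n => ⟨⟨_, hv _ hlb n⟩, rfl⟩
  rw [Polynomial.mem_lifts] at h1
  obtain ⟨q, hq⟩ := h1
  -- The translate of `l` is monic in the parameter with coefficients in `A`, so division by it
  -- stays over `A`; the constant coefficient of the quotient is `b`.
  have hm : (Polynomial.X + Polynomial.C (⟨l, hl⟩ : A)).Monic := Polynomial.monic_X_add_C _
  have h2 : translate v b = (q /ₘ (Polynomial.X + Polynomial.C (⟨l, hl⟩ : A))).map
      A.val.toRingHom := by
    rw [Polynomial.map_divByMonic _ hm, hq, map_mul, hvl]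
    simp only [Polynomial.map_add, Polynomial.map_X, Polynomial.map_C]
    exact (Polynomial.mul_divByMonic_cancel_left _ (Polynomial.monic_X_add_C l)).symm
  rw [← coeff_zero_translate v b, h2, Polynomial.coeff_map]
  exact Subtype.property _

theorem IsTranslationStable.map {A : Subalgebra k (MvPolynomial σ k)} {v : σ → k}
    (hv : IsTranslationStable A v) {ρ : MvPolynomial σ k →ₐ[k] MvPolynomial τ k} {w : τ → k}
    (h : ∀ i, translate w (ρ (X i)) =
      Polynomial.C (ρ (X i)) + Polynomial.C (C (v i)) * Polynomial.X) :
    IsTranslationStable (A.map ρ) w := by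
  rintro _ ⟨a, ha, rfl⟩ n
  have h1 : (translate w).comp ρ = (Polynomial.mapAlgHom ρ).comp (translate v) := by
    ext i : 1
    simp [translate_X, h, ← algebraMap_eq]
  have h2 := DFunLike.congr_fun h1 a
  simp only [AlgHom.comp_apply] at h2
  refine ⟨(translate v a).coeff n, hv a ha n, ?_⟩
  change ρ _ = (translate w (ρ a)).coeff n
  rw [h2, Polynomial.coeff_mapAlgHom_apply]

theorem isHomogeneous_expand {p : ℕ} {f : MvPolynomial τ k} {d : ℕ} (hf : f.IsHomogeneous d) :
    (expand p f).IsHomogeneous (p * d) := by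
  rw [expand, bind₁]
  exact IsHomogeneous.aeval hf _ fun i => isHomogeneous_X_pow i p

theorem homogeneousComponent_expand {p : ℕ} (hp : 0 < p) (f : MvPolynomial τ k) (d : ℕ) :
    homogeneousComponent (p * d) (expand p f) = expand p (homogeneousComponent d f) := by
  conv_lhs => rw [← sum_homogeneousComponent f, map_sum, map_sum]
  have h : ∀ i, homogeneousComponent (p * d) (expand p (homogeneousComponent i f)) =
      if i = d then expand p (homogeneousComponent i f) else 0 := by
    intro i
    rw [homogeneousComponent_of_mem (isHomogeneous_expand (homogeneousComponent_isHomogeneous i f))]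
    simp [eq_comm, hp.ne']
  simp only [h, Finset.sum_ite_eq', Finset.mem_range]
  split_ifs with hn
  · rfl
  · rw [homogeneousComponent_eq_zero _ _ (by omega), map_zero]

/-- Frobenius is additive, so `(X j + v j * t) ^ p = X j ^ p + v j ^ p * t ^ p`, and the coordinates
`0` and `1` of a standard basis vector equal their `p`-th powers. -/
theorem translate_single_expand [DecidableEq τ] (p : ℕ) [Fact p.Prime] [CharP k p] (i : τ)
    (f : MvPolynomial τ k) :
    translate (Pi.single i 1) (expand p f) =
      Polynomial.expand _ p (Polynomial.mapAlgHom (expand p) (translate (Pi.single i 1) f)) := by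
  have h : (translate (Pi.single i (1 : k))).comp (expand p) =
      ((Polynomial.expand (MvPolynomial τ k) p).restrictScalars k).comp
        ((Polynomial.mapAlgHom (expand p)).comp (translate (Pi.single i (1 : k)))) := by
    ext j : 1
    have : Fact (Nat.Prime p) := inferInstance
    have h1 : ((Pi.single i 1 : τ → k) j) ^ p = (Pi.single i 1 : τ → k) j := by
      by_cases hj : j = i
      · subst hj; simp
      · simp [hj, this.out.ne_zero]
    have : CharP (Polynomial (MvPolynomial τ k)) p :=
      charP_of_injective_ringHom (f := Polynomial.C.comp C)
        (Polynomial.C_injective.comp (C_injective τ k)) p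
    simp only [AlgHom.comp_apply, expand_X, map_pow, translate_X, add_pow_char, mul_pow, map_add,
      map_mul, AlgHom.coe_restrictScalars', Polynomial.coe_mapAlgHom, Polynomial.map_C,
      Polynomial.map_X, Polynomial.expand_C, Polynomial.expand_X]
    simp [← map_pow, h1]
  exact DFunLike.congr_fun h f

theorem IsTranslationStable.comap_expand [DecidableEq τ] {p : ℕ} [hp : Fact (Nat.Prime p)]
    [CharP k p]
    {A : Subalgebra k (MvPolynomial τ k)} {i : τ} (hA : IsTranslationStable A (Pi.single i 1)) :
    IsTranslationStable (A.comap (expand p)) (Pi.single i 1) := by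
  intro a ha n
  have h : (translate (Pi.single i 1) (expand p a)).coeff (n * p) ∈ A := hA _ ha (n * p)
  rw [translate_single_expand, Polynomial.coeff_expand_mul hp.out.pos,
    Polynomial.coeff_mapAlgHom_apply] at h
  exact h

theorem exists_expand_eq_of_dvd {p : ℕ} {a : MvPolynomial τ k}
    (h : ∀ γ ∈ a.support, ∀ i, p ∣ γ i) : ∃ b, expand p b = a := by
  have hγ : ∀ γ : τ →₀ ℕ, (∀ i, p ∣ γ i) → p • γ.mapRange (· / p) (Nat.zero_div p) = γ := by
    intro γ h
    ext i
    simp [Nat.mul_div_cancel' (h i)]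
  refine ⟨∑ γ ∈ a.support, monomial (γ.mapRange (· / p) (Nat.zero_div p)) (a.coeff γ), ?_⟩
  rw [map_sum]
  conv_rhs => rw [a.as_sum]
  refine Finset.sum_congr rfl fun γ h' => ?_
  rw [expand_monomial, hγ γ (h γ h')]

end Translation

/-! ### Generators of translation stable algebras -/

section Generators

variable {k : Type*} [Field k]

theorem eq_bot_of_forall_isHomogeneous {τ : Type*} {A : Subalgebra k (MvPolynomial τ k)}
    (hA : IsGraded A) (h : ∀ N, 0 < N → ∀ a ∈ A, a.IsHomogeneous N → a = 0) : A = ⊥ := by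
  refine le_antisymm (fun a ha => ?_) bot_le
  refine mem_of_homogeneousComponent_mem fun d => ?_
  rcases Nat.eq_zero_or_pos d with rfl | hd
  · rw [homogeneousComponent_zero]
    exact Subalgebra.algebraMap_mem _ _
  · rw [h d hd _ (hA a ha d) (homogeneousComponent_isHomogeneous d a)]
    exact zero_mem _

/-- Eliminating one variable by means of `l = 0` gives a map `ρ` to `u` variables with kernel `(l)`.
The image of `A` is again graded and translation stable, and an element of `A` killed by `ρ` is `l`
times an element of `A`, by `mem_of_mul_mem`. So lifts of `u` generators of the image, together with
`l`, generate `A`. -/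
theorem exists_generators_of_linear_form {u : ℕ}
    (ih : ∀ A : Subalgebra k (MvPolynomial (Fin u) k), IsGraded A →
      (∀ v, IsTranslationStable A v) →
      ∃ g : Fin u → MvPolynomial (Fin u) k,
        (∀ j, ∃ d, (g j).IsHomogeneous d) ∧ Algebra.adjoin k (Set.range g) = A)
    {A : Subalgebra k (MvPolynomial (Fin (u + 1)) k)} (hA : IsGraded A)
    (hst : ∀ v, IsTranslationStable A v) {l : MvPolynomial (Fin (u + 1)) k} (hlA : l ∈ A)
    (hl : l.IsHomogeneous 1) (hl0 : l ≠ 0) :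
    ∃ g : Fin (u + 1) → MvPolynomial (Fin (u + 1)) k,
        (∀ j, ∃ d, (g j).IsHomogeneous d) ∧ Algebra.adjoin k (Set.range g) = A := by
  obtain ⟨c, rfl⟩ : ∃ c : Fin (u + 1) → k, l = ∑ i, C (c i) * X i := by
    have : l ∈ Submodule.span k (Set.range (X : Fin (u + 1) → MvPolynomial _ k)) := by
      rw [← homogeneousSubmodule_one_eq_span_X]; exact hl
    obtain ⟨c, hc⟩ := (Submodule.mem_span_range_iff_exists_fun k).1 this
    exact ⟨c, by rw [← hc]; simp [MvPolynomial.smul_eq_C_mul]⟩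
  obtain ⟨j, hj⟩ : ∃ j, c j ≠ 0 := by
    by_contra! h
    exact hl0 (by simp [h])
  have htr : ∀ v, translate v (∑ i, C (c i) * X i : MvPolynomial (Fin (u + 1)) k) =
      Polynomial.C (∑ i, C (c i) * X i) + Polynomial.C (C (∑ i, c i * v i)) * Polynomial.X := by
    intro v
    simp only [map_sum, map_mul, translate_X, translate_C, mul_add, Finset.sum_add_distrib,
      Finset.sum_mul, mul_assoc]
  let ρ : MvPolynomial (Fin (u + 1)) k →ₐ[k] MvPolynomial (Fin u) k :=
    aeval (j.insertNth (∑ i, C (-((c j)⁻¹ * c (j.succAbove i))) * X i) X)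
  have hρj : ρ (X j) = ∑ i, C (-((c j)⁻¹ * c (j.succAbove i))) * X i := by simp [ρ]
  have hρi : ∀ i, ρ (X (j.succAbove i)) = X i := by intro i; simp [ρ]
  have hρ : ∀ d f, f.IsHomogeneous d → (ρ f).IsHomogeneous d := by
    refine isHomogeneous_aeval_of_linear fun i => ?_
    refine j.succAboveCases ?_ (fun i => ?_) i
    · rw [Fin.insertNth_apply_same]
      exact (IsHomogeneous.sum _ _ _ fun i _ => isHomogeneous_C_mul_X _ i)
    · rw [Fin.insertNth_apply_succAbove]; exact isHomogeneous_X _ i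
  have hst' : ∀ w, IsTranslationStable (A.map ρ) w := by
    intro w
    -- This lift of `w` lies on the hyperplane `l = 0`.
    refine (hst (j.insertNth (∑ i, -((c j)⁻¹ * c (j.succAbove i)) * w i) w)).map fun i => ?_
    refine j.succAboveCases ?_ (fun i => ?_) i
    · rw [hρj, Fin.insertNth_apply_same]
      simp only [map_sum, map_mul, translate_X, translate_C, mul_add,
        Finset.sum_add_distrib, Finset.sum_mul, mul_assoc]
    · rw [hρi, Fin.insertNth_apply_succAbove, translate_X]
  obtain ⟨g, hg, hgA⟩ := ih _ (hA.map hρ) hst'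
  have hdvd : ∀ f, ρ f = 0 → (∑ i, C (c i) * X i : MvPolynomial (Fin (u + 1)) k) ∣ f := by
    intro f hf
    -- Modulo `l`, applying `ρ` and renaming back is the identity on every variable.
    let I := Ideal.span {(∑ i, C (c i) * X i : MvPolynomial (Fin (u + 1)) k)}
    have h : (Ideal.Quotient.mkₐ k I).comp ((rename j.succAbove).comp ρ) =
        Ideal.Quotient.mkₐ k I := by
      ext i
      simp only [AlgHom.comp_apply, Ideal.Quotient.mkₐ_eq_mk]
      rw [Ideal.Quotient.mk_eq_mk_iff_sub_mem]
      refine j.succAboveCases ?_ (fun i => ?_) i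
      · rw [hρj, Ideal.mem_span_singleton]
        refine ⟨-C (c j)⁻¹, ?_⟩
        rw [Fin.sum_univ_succAbove _ j]
        simp only [map_neg, map_sum, map_mul, rename_C, rename_X]
        have : (C (c j) * C (c j)⁻¹ : MvPolynomial (Fin (u + 1)) k) = 1 := by
          rw [← C_mul, mul_inv_cancel₀ hj, C_1]
        rw [add_mul, mul_right_comm, mul_neg, this, Finset.sum_mul, sub_eq_neg_add, neg_one_mul]
        refine congrArg₂ _ rfl (Finset.sum_congr rfl fun i _ => ?_)
        ring
      · rw [hρi, rename_X, sub_self]; exact zero_mem _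
    have h2 := DFunLike.congr_fun h f
    simp only [AlgHom.comp_apply, hf, map_zero, Ideal.Quotient.mkₐ_eq_mk] at h2
    rwa [eq_comm, Ideal.Quotient.eq_zero_iff_mem, Ideal.mem_span_singleton] at h2
  obtain ⟨G, hG, hGA⟩ := exists_homogeneous_generators_of_map (α := Unit) hA hρ
    (h := fun _ => ∑ i, C (c i) * X i) (e := fun _ => 1) (fun _ => one_pos) (fun _ => hl)
    (fun _ => hlA) (fun f hf h0 => by
      obtain ⟨b, hb⟩ := hdvd f h0
      refine ⟨fun _ => b, fun _ => ?_, by simp [hb, mul_comm]⟩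
      -- Along this vector `l` has slope one.
      refine (hst (Pi.single j (c j)⁻¹)).mem_of_mul_mem hlA ?_ (hb ▸ hf)
      have : ∑ i, c i * (Pi.single j (c j)⁻¹ : Fin (u + 1) → k) i = 1 := by
        rw [Finset.sum_eq_single j (by intro i _ h; simp [h]) (by simp)]
        simp [hj]
      rw [htr, this, C_1, map_one, one_mul]
      exact add_comm _ _) hg hgA
  let e : Fin (u + 1) ≃ Unit ⊕ Fin u :=
    Fintype.equivOfCardEq (by simp [add_comm])
  refine ⟨G ∘ e, fun i => hG _, ?_⟩
  rw [EquivLike.range_comp, hGA]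

/-- A graded translation stable subalgebra of a polynomial ring in `u` variables is generated by
`u` homogeneous elements. -/
theorem exists_generators_of_isTranslationStable (u : ℕ) :
    ∀ A : Subalgebra k (MvPolynomial (Fin u) k), IsGraded A →
      (∀ v, IsTranslationStable A v) →
      ∃ g : Fin u → MvPolynomial (Fin u) k,
        (∀ j, ∃ d, (g j).IsHomogeneous d) ∧ Algebra.adjoin k (Set.range g) = A := by
  induction u using Nat.strong_induction_on with
  | _ u ihu =>
  -- The inner induction is on the degree of some nonzero form in `A`: it drops by the factor `p`
  -- under descent along `expand p`, and the number of variables drops when there is a linear form.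
  have key : ∀ N, ∀ A : Subalgebra k (MvPolynomial (Fin u) k), IsGraded A →
      (∀ v, IsTranslationStable A v) → (0 < N ∧ ∃ a ∈ A, a.IsHomogeneous N ∧ a ≠ 0) →
      ∃ g : Fin u → MvPolynomial (Fin u) k,
        (∀ j, ∃ d, (g j).IsHomogeneous d) ∧ Algebra.adjoin k (Set.range g) = A := by
    intro N
    induction N using Nat.strong_induction_on with
    | _ N ihN =>
    rintro A hA hst ⟨hN, a, haA, haN, ha0⟩
    by_cases hlin : ∀ a ∈ A, a.IsHomogeneous 1 → a = 0
    -- Without linear forms all partial derivatives vanish on `A`, so every exponent occurring is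
    -- zero in `k`.
    · have hd : ∀ b ∈ A, ∀ γ ∈ b.support, ∀ i, ((γ i : ℕ) : k) = 0 := by
        intro b hb γ hγ i
        rcases Nat.eq_zero_or_pos (γ i) with h | h
        · rw [h, Nat.cast_zero]
        have h1 := congrArg (coeff (γ - Finsupp.single i 1))
          (pderiv_eq_zero_of_isTranslationStable hA (fun i => hst _) hlin i b hb)
        rw [coeff_pderiv, coeff_zero, tsub_add_cancel_of_le (by simpa using! h)] at h1
        have h2 := (mul_eq_zero.1 h1).resolve_left (mem_support_iff.1 hγ)
        rw [Finsupp.tsub_apply, Finsupp.single_eq_same] at h2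
        rw [← h2, Nat.cast_sub (by omega)]
        simp
      obtain ⟨p, hp⟩ := CharP.exists k
      rcases CharP.char_is_prime_or_zero k p with hpp | rfl
      · have : Fact p.Prime := ⟨hpp⟩
        have hex : ∀ b ∈ A, ∃ b', expand p b' = b := fun b hb =>
          exists_expand_eq_of_dvd fun γ hγ i =>
            (CharP.cast_eq_zero_iff k p _).1 (hd b hb γ hγ i)
        obtain ⟨b, rfl⟩ := hex a haA
        have hAg : IsGraded (A.comap (expand p)) := by
          intro b hb d
          change expand p _ ∈ A
          rw [← homogeneousComponent_expand hpp.pos]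
          exact hA _ hb _
        have hM : ∃ M, 0 < M ∧ M < N ∧ b.IsHomogeneous M := by
          have hb0 : b ≠ 0 := by rintro rfl; exact ha0 (map_zero _)
          obtain ⟨γ, hγ⟩ := Finset.nonempty_of_ne_empty (mt support_eq_empty.1 hb0)
          have hdeg : ∀ γ ∈ b.support, p * γ.degree = N := by
            intro γ hγ
            by_contra h
            refine (mem_support_iff.1 hγ) ?_
            rw [← coeff_expand_smul p hpp.ne_zero]
            exact haN.coeff_eq_zero (by rwa [map_nsmul, smul_eq_mul])
          refine ⟨γ.degree, ?_, ?_, ?_⟩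
          · have := hdeg γ hγ
            exact Nat.pos_of_ne_zero fun h => by rw [h] at this; omega
          · rw [← hdeg γ hγ]
            have := hpp.two_le
            have := hdeg γ hγ
            have : 0 < γ.degree := Nat.pos_of_ne_zero fun h => by rw [h] at this; omega
            nlinarith
          · intro δ hδ
            rw [show Finsupp.weight 1 δ = δ.degree from
              (DFunLike.congr_fun Finsupp.degree_eq_weight_one δ).symm]
            have h1 := hdeg γ hγ
            have h2 := hdeg δ (mem_support_iff.2 hδ)
            exact Nat.eq_of_mul_eq_mul_left hpp.pos (h2.trans h1.symm)
        obtain ⟨M, hM0, hMN, hbM⟩ := hM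
        obtain ⟨g, hg, hgA⟩ := ihN M hMN (A.comap (expand p)) hAg
          (isTranslationStable_of_single fun i => (hst _).comap_expand)
          ⟨hM0, b, haA, hbM, by rintro rfl; exact ha0 (map_zero _)⟩
        refine ⟨fun j => expand p (g j), fun j => ?_, ?_⟩
        · obtain ⟨d, hd⟩ := hg j
          exact ⟨_, isHomogeneous_expand hd⟩
        · have : Set.range (fun j => expand p (g j)) = expand p '' Set.range g := by
            rw [← Set.range_comp]; rfl
          rw [this, ← AlgHom.map_adjoin, hgA]
          refine le_antisymm ?_ ?_
          · rintro _ ⟨x, hx, rfl⟩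
            exact hx
          · intro x hx
            obtain ⟨y, rfl⟩ := hex x hx
            exact ⟨y, hx, rfl⟩
      · have : CharZero k := CharP.charP_to_charZero k
        exfalso
        obtain ⟨γ, hγ⟩ := Finset.nonempty_of_ne_empty (mt support_eq_empty.1 ha0)
        have h1 : γ = 0 := by
          ext i
          simpa using hd a haA γ hγ i
        have h2 := haN (mem_support_iff.1 hγ)
        rw [h1, map_zero] at h2
        omega
    · push Not at hlin
      obtain ⟨l, hlA, hl, hl0⟩ := hlin
      rcases u with _ | u
      · exfalso
        refine hl0 ?_
        obtain ⟨r, rfl⟩ := C_surjective (Fin 0) l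
        have := hl.coeff_eq_zero (d := 0) (by simp)
        rw [coeff_zero_C] at this
        rw [this, C_0]
      · exact exists_generators_of_linear_form (ihu u (by omega)) hA hst hlA hl hl0
  intro A hA hst
  by_cases h : ∀ N, 0 < N → ∀ a ∈ A, a.IsHomogeneous N → a = 0
  · refine ⟨fun _ => 0, fun _ => ⟨0, isHomogeneous_zero _ _ _⟩, ?_⟩
    rw [eq_bot_of_forall_isHomogeneous hA h, eq_bot_iff, Algebra.adjoin_le_iff]
    rintro _ ⟨_, rfl⟩
    exact zero_mem _
  · push Not at h
    obtain ⟨N, hN, a, ha, haN, ha0⟩ := h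
    exact key N A hA hst ⟨hN, a, ha, haN, ha0⟩

end Generators

/-! ### Invariants modulo the eigenvectors and fixed forms -/

section Retract

variable {k : Type*} [Field k] {α : Type*} {u : ℕ}

theorem mem_span_of_aeval_sumElim_eq_zero {f : MvPolynomial (α ⊕ Fin u) k}
    (hf : aeval (Sum.elim (fun _ => 0) X : α ⊕ Fin u → MvPolynomial (Fin u) k) f = 0) :
    f ∈ Ideal.span (X '' Set.range (Sum.inl : α → α ⊕ Fin u) :
      Set (MvPolynomial (α ⊕ Fin u) k)) := by
  let I := Ideal.span (X '' Set.range (Sum.inl : α → α ⊕ Fin u) :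
      Set (MvPolynomial (α ⊕ Fin u) k))
  have h : (Ideal.Quotient.mkₐ k I).comp ((rename Sum.inr).comp
      (aeval (Sum.elim (fun _ => 0) X : α ⊕ Fin u → MvPolynomial (Fin u) k))) =
        Ideal.Quotient.mkₐ k I := by
    ext i
    rcases i with i | i
    · simp only [AlgHom.comp_apply, aeval_X, Sum.elim_inl, map_zero, Ideal.Quotient.mkₐ_eq_mk]
      have hi : X (Sum.inl i) ∈ I := Ideal.subset_span ⟨_, ⟨i, rfl⟩, rfl⟩
      exact (Ideal.Quotient.eq_zero_iff_mem.2 hi).symm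
    · simp
  have h2 := DFunLike.congr_fun h f
  simp only [AlgHom.comp_apply, hf, map_zero, Ideal.Quotient.mkₐ_eq_mk] at h2
  exact Ideal.Quotient.eq_zero_iff_mem.1 h2.symm

/-- A graded subalgebra `R` that is a direct summand, is stable under translations of the second
group of variables, contains powers `X i ^ c i` of the first variables and involves these variables
only with exponents `0` or at least `c i` is generated by as many homogeneous elements as there are
variables. -/
theorem exists_generators_of_retract [Fintype α] {R : Subalgebra k (MvPolynomial (α ⊕ Fin u) k)}
    (hR : IsGraded R) (hst : ∀ v : Fin u → k, IsTranslationStable R (Sum.elim 0 v))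
    {c : α → ℕ} (hc : ∀ i, 0 < c i) (hcR : ∀ i, X (Sum.inl i) ^ c i ∈ R)
    (hexp : ∀ f ∈ R, ∀ γ ∈ f.support, ∀ i, γ (Sum.inl i) ≠ 0 → c i ≤ γ (Sum.inl i))
    (π : MvPolynomial (α ⊕ Fin u) k →+ MvPolynomial (α ⊕ Fin u) k)
    (hπR : ∀ s, π s ∈ R) (hπmul : ∀ r ∈ R, ∀ s, π (r * s) = r * π s) (hπ1 : π 1 = 1) :
    ∃ G : α ⊕ Fin u → MvPolynomial (α ⊕ Fin u) k,
      (∀ x, ∃ d, (G x).IsHomogeneous d) ∧ Algebra.adjoin k (Set.range G) = R := by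
  let ρ : MvPolynomial (α ⊕ Fin u) k →ₐ[k] MvPolynomial (Fin u) k :=
    aeval (Sum.elim (fun _ => 0) X)
  have hρ : ∀ d f, f.IsHomogeneous d → (ρ f).IsHomogeneous d := by
    refine isHomogeneous_aeval_of_linear ?_
    rintro (i | i)
    · exact isHomogeneous_zero _ _ _
    · exact isHomogeneous_X _ i
  have hst' : ∀ w, IsTranslationStable (R.map ρ) w := by
    intro w
    refine (hst w).map ?_
    rintro (i | i)
    · simp [ρ]
    · simp [ρ, translate_X]
  obtain ⟨g, hg, hgA⟩ := exists_generators_of_isTranslationStable u _ (hR.map hρ) hst'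
  refine exists_homogeneous_generators_of_map hR hρ hc (fun i => isHomogeneous_X_pow _ _) hcR
    (fun f hf h0 => ?_) hg hgA
  have h1 := (mem_ideal_span_X_image.1 (mem_span_of_aeval_sumElim_eq_zero h0))
  have h2 : f ∈ Ideal.span (Set.range fun i : α => (X (Sum.inl i) ^ c i :
      MvPolynomial (α ⊕ Fin u) k)) := by
    rw [f.as_sum]
    refine sum_mem fun γ hγ => ?_
    obtain ⟨_, ⟨i, rfl⟩, hi⟩ := h1 γ hγ
    have h3 : Finsupp.single (Sum.inl i) (c i) ≤ γ := by
      rw [Finsupp.single_le_iff]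
      exact hexp f hf γ hγ i hi
    have h4 : monomial γ (f.coeff γ) = monomial (γ - Finsupp.single (Sum.inl i) (c i)) (f.coeff γ) *
        X (Sum.inl i) ^ c i := by
      rw [X_pow_eq_monomial, monomial_mul, tsub_add_cancel_of_le h3, mul_one]
    rw [h4]
    exact Ideal.mul_mem_left _ _ (Ideal.subset_span ⟨i, rfl⟩)
  obtain ⟨r, hr⟩ := (Ideal.mem_span_range_iff_exists_fun).1 h2
  -- The `r i` are arbitrary polynomials; since `f` and the powers `X i ^ c i` lie in `R`, applying
  -- `π` to the relation moves its coefficients into `R`.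
  refine ⟨fun i => π (r i), fun i => hπR _, ?_⟩
  calc f = π (f * 1) := by rw [hπmul f hf, hπ1, mul_one]
    _ = ∑ i, π (r i) * X (Sum.inl i) ^ c i := by
      rw [mul_one, ← hr, map_sum]
      refine Finset.sum_congr rfl fun i _ => ?_
      rw [mul_comm, hπmul _ (hcR i), mul_comm]

end Retract

/-! ### Fixed points in adapted coordinates -/

section FixedBy

variable {k : Type*} [Field k] {τ : Type*}

/-- The hypothesis says that each `φ` commutes with translation by `v`, so it fixes each coefficient
of the translate of an element which it fixes. -/
theorem isTranslationStable_of_fixed {R : Subalgebra k (MvPolynomial τ k)}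
    {Φ : Set (MvPolynomial τ k →ₐ[k] MvPolynomial τ k)}
    (hR : ∀ f, f ∈ R ↔ ∀ φ ∈ Φ, φ f = f) {v : τ → k}
    (h : ∀ φ ∈ Φ, ∀ i, translate v (φ (X i)) =
      Polynomial.C (φ (X i)) + Polynomial.C (C (v i)) * Polynomial.X) :
    IsTranslationStable R v := by
  intro a ha n
  rw [hR] at ha ⊢
  intro φ hφ
  have h1 : (translate v).comp φ = (Polynomial.mapAlgHom φ).comp (translate v) := by
    ext i : 1
    simp [translate_X, h φ hφ, ← algebraMap_eq]
  have h2 := DFunLike.congr_fun h1 a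
  simp only [AlgHom.comp_apply, ha φ hφ] at h2
  conv_rhs => rw [h2]
  rw [Polynomial.coeff_mapAlgHom_apply]

theorem coeff_aeval_C_mul_X [Fintype τ] (χ : τ → k) (f : MvPolynomial τ k) (γ : τ →₀ ℕ) :
    coeff γ (aeval (fun i => C (χ i) * X i : τ → MvPolynomial τ k) f) =
      (∏ i, χ i ^ γ i) * coeff γ f := by
  classical
  induction f using MvPolynomial.induction_on' with
  | add p q hp hq => rw [map_add, coeff_add, hp, hq, coeff_add, mul_add]
  | monomial δ a =>
    have : aeval (fun i => C (χ i) * X i : τ → MvPolynomial τ k) (monomial δ a) =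
        monomial δ (a * ∏ i, χ i ^ δ i) := by
      rw [aeval_monomial, monomial_eq, Finsupp.prod_fintype _ _ (by simp),
        Finsupp.prod_fintype _ _ (by simp)]
      simp only [mul_pow, Finset.prod_mul_distrib, algebraMap_eq, C_mul, map_prod, map_pow]
      ring
    rw [this, coeff_monomial, coeff_monomial]
    split_ifs with h
    · rw [h, mul_comm]
    · rw [mul_zero]

end FixedBy

section Coordinates

variable {k : Type*} [Field k]

theorem isGraded_of_fixed {τ : Type*} {R : Subalgebra k (MvPolynomial τ k)}
    {Φ : Set (MvPolynomial τ k →ₐ[k] MvPolynomial τ k)}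
    (hR : ∀ f, f ∈ R ↔ ∀ φ ∈ Φ, φ f = f)
    (hΦ : ∀ φ ∈ Φ, ∀ d f, f.IsHomogeneous d → (φ f).IsHomogeneous d) : IsGraded R := by
  intro f hf d
  rw [hR] at hf ⊢
  intro φ hφ
  rw [← map_homogeneousComponent (hΦ φ hφ), hf φ hφ]

/-- A finite group acting diagonally on variables indexed by `T`, trivially on variables indexed by
`M` and by translations by forms in the latter on the remaining variables has its invariants
generated by as many homogeneous elements as there are variables, provided that the invariants are
a direct summand and that the diagonal part of the action is split. -/
theorem exists_generators_of_coordinates {Γ : Type*} [Group Γ] [Finite Γ] {T M : Type*} [Fintype T]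
    [Fintype M] {u : ℕ}
    (Φ : Γ →* (MvPolynomial ((T ⊕ M) ⊕ Fin u) k →ₐ[k] MvPolynomial ((T ⊕ M) ⊕ Fin u) k))
    {χ : Γ → T → k}
    (hT : ∀ g i, Φ g (X (Sum.inl (Sum.inl i))) = C (χ g i) * X (Sum.inl (Sum.inl i)))
    (hM : ∀ g i, Φ g (X (Sum.inl (Sum.inr i))) = X (Sum.inl (Sum.inr i)))
    (hY : ∀ g j, ∃ m : M → k,
      Φ g (X (Sum.inr j)) = X (Sum.inr j) + ∑ i, C (m i) * X (Sum.inl (Sum.inr i)))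
    (hsplit : ∀ g i, ∃ g', Φ g' (X (Sum.inl (Sum.inl i))) = C (χ g i) * X (Sum.inl (Sum.inl i)) ∧
      ∀ x, x ≠ Sum.inl (Sum.inl i) → Φ g' (X x) = X x)
    {R : Subalgebra k (MvPolynomial ((T ⊕ M) ⊕ Fin u) k)} (hR : ∀ f, f ∈ R ↔ ∀ g, Φ g f = f)
    (π : MvPolynomial ((T ⊕ M) ⊕ Fin u) k →+ MvPolynomial ((T ⊕ M) ⊕ Fin u) k)
    (hπR : ∀ s, π s ∈ R) (hπmul : ∀ r ∈ R, ∀ s, π (r * s) = r * π s) (hπ1 : π 1 = 1) :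
    ∃ G : (T ⊕ M) ⊕ Fin u → MvPolynomial ((T ⊕ M) ⊕ Fin u) k,
      (∀ x, ∃ d, (G x).IsHomogeneous d) ∧ Algebra.adjoin k (Set.range G) = R := by
  classical
  have hR' : ∀ f, f ∈ R ↔ ∀ φ ∈ Set.range Φ, φ f = f := by
    intro f; rw [hR, Set.forall_mem_range]
  have hlin : ∀ g x, (Φ g (X x)).IsHomogeneous 1 := by
    rintro g ((i | i) | j)
    · rw [hT]; exact isHomogeneous_C_mul_X _ _
    · rw [hM]; exact isHomogeneous_X _ _
    · obtain ⟨m, hm⟩ := hY g j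
      rw [hm]
      exact (isHomogeneous_X _ _).add (IsHomogeneous.sum _ _ _ fun i _ => isHomogeneous_C_mul_X _ _)
  have hgr : IsGraded R := by
    refine isGraded_of_fixed hR' ?_
    rintro _ ⟨g, rfl⟩ d f hf
    rw [aeval_unique (Φ g)]
    exact isHomogeneous_aeval_of_linear (hlin g) d f hf
  have hst : ∀ v : Fin u → k, IsTranslationStable R (Sum.elim 0 v) := by
    intro v
    refine isTranslationStable_of_fixed hR' ?_
    rintro _ ⟨g, rfl⟩ ((i | i) | j)
    · simp [hT, translate_X]
    · simp [hM, translate_X]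
    · obtain ⟨m, hm⟩ := hY g j
      simp [hm, translate_X]
      ring
  have hχ : ∀ g i n, Φ (g ^ n) (X (Sum.inl (Sum.inl i))) =
      C (χ g i ^ n) * X (Sum.inl (Sum.inl i)) := by
    intro g i n
    induction n with
    | zero => simp
    | succ n ih =>
      rw [pow_succ', map_mul, AlgHom.mul_apply, ih, map_mul, hT, ← algebraMap_eq, AlgHom.commutes,
        algebraMap_eq, ← mul_assoc, ← C_mul, pow_succ]
  have hχinj : ∀ i (a : k), C a * X (Sum.inl (Sum.inl i)) =
      (X (Sum.inl (Sum.inl i)) : MvPolynomial ((T ⊕ M) ⊕ Fin u) k) → a = 1 := by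
    intro i a h
    have := congrArg (coeff (Finsupp.single (Sum.inl (Sum.inl i)) 1)) h
    simpa using this
  have hex : ∀ i, ∃ e, 0 < e ∧ ∀ g, χ g i ^ e = 1 := by
    refine fun i => ⟨Nat.card Γ, Nat.card_pos, fun g => hχinj i _ ?_⟩
    rw [← hχ, pow_card_eq_one']
    simp
  -- The exponent is the least positive one trivialising all values of the character; fixed
  -- variables are themselves invariant.
  let c : T ⊕ M → ℕ := Sum.elim (fun i => Nat.find (hex i)) fun _ => 1
  refine exists_generators_of_retract (c := c) hgr hst ?_ ?_ ?_ π hπR hπmul hπ1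
  · rintro (i | i)
    · exact (Nat.find_spec (hex i)).1
    · exact one_pos
  · rintro (i | i)
    · rw [hR]
      intro g
      have : χ g i ^ c (Sum.inl i) = 1 := (Nat.find_spec (hex i)).2 g
      rw [map_pow, hT, mul_pow, ← C_pow, this, C_1, one_mul]
    · rw [hR]
      intro g
      rw [map_pow, hM]
  · rintro f hf γ hγ (i | i) h0
    · refine Nat.find_min' (hex i) ⟨Nat.pos_of_ne_zero h0, fun g => ?_⟩
      -- Since `g'` scales this variable alone, invariance forces `χ g i ^ γ i = 1` for every
      -- monomial occurring; `Nat.find_min'` then gives the bound.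
      obtain ⟨g', hg', hg'x⟩ := hsplit g i
      have h1 : Φ g' = aeval (fun x => C (if x = Sum.inl (Sum.inl i) then χ g i else 1) * X x) := by
        ext x : 1
        rw [aeval_X]
        split_ifs with hx
        · rw [hx, hg']
        · rw [hg'x x hx, C_1, one_mul]
      have h2 := congrArg (coeff γ) ((hR f).1 hf g')
      rw [h1, coeff_aeval_C_mul_X] at h2
      have h3 := mul_right_cancel₀ (mem_support_iff.1 hγ) (h2.trans (one_mul _).symm)
      rw [Finset.prod_eq_single (Sum.inl (Sum.inl i)) (fun x _ hx => by rw [if_neg hx, one_pow])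
        (by simp)] at h3
      simpa using h3
    · exact Nat.pos_of_ne_zero h0

end Coordinates

/-! ### Algebraic independence and integrality -/

section Independence

variable {k : Type*} [Field k]

/-- Generators, indexed by the variables, of a subalgebra over which the polynomial ring is
algebraic are algebraically independent. -/
theorem algebraicIndependent_of_adjoin_eq {ι : Type*} [Finite ι]
    {R : Subalgebra k (MvPolynomial ι k)} [hR : Algebra.IsAlgebraic R (MvPolynomial ι k)]
    {g : ι → MvPolynomial ι k} (hg : Algebra.adjoin k (Set.range g) = R) :
    AlgebraicIndependent k g := by
  subst hg
  -- The family has as many members as the transcendence degree of the polynomial ring, which is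
  -- algebraic over the algebra they generate.
  refine (Algebra.IsAlgebraic.isTranscendenceBasis_of_lift_le_trdeg_of_finite k g ?_).1
  rw [MvPolynomial.trdeg_of_isDomain]
  simp

/-- A ring is integral over the fixed points of a finite group. -/
theorem isIntegral_of_fixed {Γ : Type*} [Group Γ] [Finite Γ] {S : Type*} [CommRing S] [Algebra k S]
    (Φ : Γ →* (S →ₐ[k] S)) {R : Subalgebra k S} (hR : ∀ f, f ∈ R ↔ ∀ g, Φ g f = f) :
    Algebra.IsIntegral R S := by
  let Φ' : Γ →* (S →+* S) :=
    { toFun := fun g => (Φ g).toRingHom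
      map_one' := by ext; simp
      map_mul' := fun g h => by ext; simp }
  let _ : MulSemiringAction Γ S := MulSemiringAction.compHom S Φ'
  have : SMulCommClass Γ R S := ⟨fun g r s => by
    change Φ g ((r : S) * s) = r * Φ g s
    rw [map_mul, (hR r).1 r.2]⟩
  have : Algebra.IsInvariant R S Γ := ⟨fun b hb => ⟨⟨b, (hR b).2 hb⟩, rfl⟩⟩
  exact Algebra.IsInvariant.isIntegral R S Γ

end Independence

end MvPolynomial

namespace AbelianCoregular

/-! ### Linear algebra of commuting reflections -/

section AdaptedBasis

variable {k W Γ : Type*} [Field k] [AddCommGroup W] [Module k W]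

/-- Expand `r (s x) = s (r x)` and cancel the common terms. When a coefficient is nonzero, the two
directions must be proportional; all later facts on pairs of reflections come from this. -/
theorem reflection_comm_relation {r s : Module.End k W} (hrs : r * s = s * r)
    {φ ψ : Module.Dual k W} {l m : W} (hr : ∀ x, r x = x + φ x • l) (hs : ∀ x, s x = x + ψ x • m)
    (x : W) : (ψ x * φ m) • l = (φ x * ψ l) • m := by
  have h := DFunLike.congr_fun hrs x
  simp only [Module.End.mul_apply, hr, hs, map_add, map_smul, add_smul, smul_eq_mul] at h
  have h2 : (x + ψ x • m + (φ x • l + (ψ x * φ m) • l)) - (x + φ x • l + ψ x • m) =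
      (x + φ x • l + (ψ x • m + (φ x * ψ l) • m)) - (x + φ x • l + ψ x • m) := by rw [h]
  have h3 : (x + ψ x • m + (φ x • l + (ψ x * φ m) • l)) - (x + φ x • l + ψ x • m) =
      (ψ x * φ m) • l := by abel
  have h4 : (x + φ x • l + (ψ x • m + (φ x * ψ l) • m)) - (x + φ x • l + ψ x • m) =
      (φ x * ψ l) • m := by abel
  rw [← h3, h2, h4]

/-- Taking `x` with `φ x ≠ 0` shows that the direction of a reflection is an eigenvector of every
map commuting with it. -/
theorem reflection_comm_eigen {r s : Module.End k W} (hrs : r * s = s * r)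
    {φ : Module.Dual k W} {l : W} (hr : ∀ x, r x = x + φ x • l) (x : W) :
    φ (s x) • l = φ x • s l := by
  have h := DFunLike.congr_fun hrs x
  simp only [Module.End.mul_apply, hr, map_add, map_smul] at h
  exact add_left_cancel h

theorem exists_apply_ne_zero {φ : Module.Dual k W} (h : φ ≠ 0) : ∃ x, φ x ≠ 0 := by
  by_contra! h'
  exact h (LinearMap.ext h')

/-- Commuting linear automorphisms generated by reflections admit a basis of three kinds of vectors:
eigenvectors that are directions of diagonalizable reflections, fixed vectors, and vectors that are
moved by fixed vectors. -/
theorem exists_adapted_basis [Group Γ] [FiniteDimensional k W] (ρ : Γ →* Module.End k W)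
    (hcomm : ∀ g h, ρ g * ρ h = ρ h * ρ g) {S : Set Γ} (hS : Subgroup.closure S = ⊤)
    (hrefl : ∀ τ ∈ S, ∃ (φ : Module.Dual k W) (l : W), φ ≠ 0 ∧ l ≠ 0 ∧ ∀ x, ρ τ x = x + φ x • l) :
    ∃ (t m u : ℕ) (b : Module.Basis ((Fin t ⊕ Fin m) ⊕ Fin u) k W) (χ : Γ → Fin t → k),
      (∀ g i, ρ g (b (Sum.inl (Sum.inl i))) = χ g i • b (Sum.inl (Sum.inl i))) ∧
      (∀ g i, ρ g (b (Sum.inl (Sum.inr i))) = b (Sum.inl (Sum.inr i))) ∧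
      (∀ g j, ∃ c : Fin m → k,
        ρ g (b (Sum.inr j)) = b (Sum.inr j) + ∑ i, c i • b (Sum.inl (Sum.inr i))) ∧
      (∀ g i, ∃ g', ρ g' (b (Sum.inl (Sum.inl i))) = χ g i • b (Sum.inl (Sum.inl i)) ∧
        ∀ x, x ≠ Sum.inl (Sum.inl i) → ρ g' (b x) = b x) := by
  classical
  have hrefl' : ∀ τ : S, ∃ (φ : Module.Dual k W) (l : W), φ ≠ 0 ∧ l ≠ 0 ∧
      ∀ x, ρ τ x = x + φ x • l := fun τ => hrefl τ τ.2
  choose φ l hφ hl hρ using hrefl'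
  have hrel : ∀ (σ τ : S) x, (φ τ x * φ σ (l τ)) • l σ = (φ σ x * φ τ (l σ)) • l τ :=
    fun σ τ x => reflection_comm_relation (hcomm _ _) (hρ σ) (hρ τ) x
  have hinv : ∀ g x, ρ g⁻¹ (ρ g x) = x := by
    intro g x
    rw [← Module.End.mul_apply, ← map_mul, inv_mul_cancel, map_one, Module.End.one_apply]
  -- a maximal independent family of directions of diagonalizable reflections
  obtain ⟨κ, a, -, hspan, hli⟩ :=
    exists_linearIndependent' k fun τ : {τ : S // φ τ (l τ) ≠ 0} => l τ.1
  have : Finite κ := hli.finite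
  obtain ⟨t, ⟨e⟩⟩ := Finite.exists_equiv_fin κ
  let s : Fin t → S := fun i => (a (e.symm i)).1
  have hs : ∀ i, φ (s i) (l (s i)) ≠ 0 := fun i => (a (e.symm i)).2
  have hsli : LinearIndependent k fun i => l (s i) := hli.comp _ e.symm.injective
  have hsspan : ∀ τ : S, φ τ (l τ) ≠ 0 →
      ∃ c : Fin t → k, ∑ i, c i • l (s i) = l τ := by
    intro τ hτ
    rw [← Submodule.mem_span_range_iff_exists_fun]
    have h1 : l τ ∈ Submodule.span k (Set.range fun τ : {τ : S // φ τ (l τ) ≠ 0} => l τ.1) :=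
      Submodule.subset_span ⟨⟨τ, hτ⟩, rfl⟩
    rw [← hspan] at h1
    convert h1 using 2
    exact (e.symm.surjective.range_comp fun i => l (a i).1)
  -- Otherwise the commutation relation would be a nontrivial linear relation between two members of
  -- the independent family.
  have hort : ∀ i j, i ≠ j → φ (s i) (l (s j)) = 0 := by
    intro i j hij
    by_contra h
    obtain ⟨x, hx⟩ := exists_apply_ne_zero (hφ (s j))
    have h1 := hrel (s i) (s j) x
    rw [← sub_eq_zero, sub_eq_add_neg, ← neg_smul] at h1
    have h2 := (LinearIndepOn.pair_iff _ hij).1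
      ((linearIndepOn_univ_iff.2 hsli).mono (Set.subset_univ {i, j})) _ _ h1
    exact mul_ne_zero hx h h2.1
  have hsum : ∀ (c : Fin t → k) i, φ (s i) (∑ j, c j • l (s j)) = c i * φ (s i) (l (s i)) := by
    intro c i
    rw [map_sum,
      Finset.sum_eq_single i (fun j _ hj => by rw [map_smul, hort i j hj.symm, smul_zero])
      (by simp), map_smul, smul_eq_mul]
  -- each direction of a diagonalizable reflection is proportional to one of the family
  have hpar : ∀ τ : S, φ τ (l τ) ≠ 0 →
      ∃ i, φ (s i) (l τ) ≠ 0 ∧ ∃ d : k, d ≠ 0 ∧ l (s i) = d • l τ := by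
    intro τ hτ
    obtain ⟨i, hi⟩ : ∃ i, φ (s i) (l τ) ≠ 0 := by
      by_contra! h
      obtain ⟨c, hc⟩ := hsspan τ hτ
      refine hl τ ?_
      rw [← hc]
      refine Finset.sum_eq_zero fun i _ => ?_
      have := h i
      rw [← hc, hsum] at this
      rw [(mul_eq_zero.1 this).resolve_right (hs i), zero_smul]
    obtain ⟨x, hx⟩ := exists_apply_ne_zero (hφ τ)
    have h1 := hrel (s i) τ x
    have h0 := mul_ne_zero hx hi
    have h2 : l (s i) = ((φ τ x * φ (s i) (l τ))⁻¹ * (φ (s i) x * φ τ (l (s i)))) • l τ := by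
      rw [mul_smul, ← h1, smul_smul, inv_mul_cancel₀ h0, one_smul]
    refine ⟨i, hi, _, fun h => hl (s i) ?_, h2⟩
    rw [h2, h, zero_smul]
  -- the fixed space and the common kernel
  let M : Submodule k W := ⨅ g, LinearMap.ker (ρ g - 1)
  have hM : ∀ x, x ∈ M ↔ ∀ g, ρ g x = x := by
    intro x
    simp [M, Submodule.mem_iInf, sub_eq_zero]
  let W' : Submodule k W := ⨅ i, LinearMap.ker (φ (s i))
  have hW' : ∀ x, x ∈ W' ↔ ∀ i, φ (s i) x = 0 := by
    intro x
    simp [W', Submodule.mem_iInf]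
  have hMW' : M ≤ W' := by
    intro x hx
    rw [hW']
    intro i
    have h1 := (hM x).1 hx (s i)
    rw [hρ] at h1
    exact (smul_eq_zero.1 (add_eq_left.1 h1)).resolve_right (hl _)
  have htrans : ∀ τ : S, φ τ (l τ) = 0 → l τ ∈ M := by
    intro τ hτ
    have h1 : ∀ σ : S, ρ σ (l τ) = l τ := by
      intro σ
      suffices h : φ σ (l τ) = 0 by rw [hρ, h, zero_smul, add_zero]
      by_contra h
      obtain ⟨x, hx⟩ := exists_apply_ne_zero (hφ τ)
      have h1 := hrel σ τ x
      -- Applying `φ τ` kills the right side, as `φ τ (l τ) = 0`, and so yields `φ τ (l σ) = 0`;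
      -- then the right side of `h1` is zero while its left side is not.
      have h2 := congrArg (φ τ) h1
      rw [map_smul, map_smul, hτ, smul_zero, smul_eq_zero] at h2
      rw [h2.resolve_left (mul_ne_zero hx h), mul_zero, zero_smul, smul_eq_zero] at h1
      exact h1.elim (mul_ne_zero hx h) (hl σ)
    rw [hM]
    intro g
    have hg : g ∈ Subgroup.closure S := hS ▸ Subgroup.mem_top g
    induction hg using Subgroup.closure_induction with
    | mem σ hσ => exact h1 ⟨σ, hσ⟩
    | one => simp
    | mul g h _ _ hg hh => rw [map_mul, Module.End.mul_apply, hh, hg]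
    | inv g _ hg => conv_lhs => rw [← hg]
                    exact hinv g _
  -- A diagonalizable reflection is parallel to some `s i` and so acts trivially on `W'`; a
  -- transvection moves vectors along its direction, which lies in `M`.
  have hmove : ∀ g, ∀ y ∈ W', ρ g y - y ∈ M := by
    intro g y hy
    have hg : g ∈ Subgroup.closure S := hS ▸ Subgroup.mem_top g
    induction hg using Subgroup.closure_induction with
    | mem σ hσ =>
      have hσ' := hρ ⟨σ, hσ⟩ y
      change ρ σ y = _ at hσ'
      rw [hσ', add_sub_cancel_left]
      by_cases h : φ ⟨σ, hσ⟩ (l ⟨σ, hσ⟩) = 0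
      · exact M.smul_mem _ (htrans _ h)
      · obtain ⟨i, hi, -⟩ := hpar _ h
        have h1 := hrel (s i) ⟨σ, hσ⟩ y
        rw [(hW' y).1 hy i, zero_mul, zero_smul, smul_eq_zero] at h1
        have h2 := (mul_eq_zero.1 (h1.resolve_right (hl _))).resolve_right hi
        rw [h2, zero_smul]
        exact zero_mem _
    | one => simp
    | mul g h _ _ hg hh =>
      have h1 : ρ (g * h) y - y = ρ g (ρ h y - y) + (ρ g y - y) := by
        rw [map_mul, Module.End.mul_apply, map_sub]; abel
      rw [h1, (hM _).1 hh g]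
      exact add_mem hh hg
    | inv g _ hg =>
      have h1 : ρ g⁻¹ y - y = -ρ g⁻¹ (ρ g y - y) := by
        rw [map_sub, hinv]; abel
      rw [h1, (hM _).1 hg]
      exact neg_mem hg
  have hfix : ∀ (τ : S) i, φ τ (l τ) ≠ 0 → φ (s i) (l τ) = 0 → φ τ (l (s i)) = 0 := by
    intro τ i _ h
    have h1 := hrel (s i) τ (l (s i))
    rw [h, mul_zero, zero_smul, eq_comm, smul_eq_zero] at h1
    exact (mul_eq_zero.1 (h1.resolve_right (hl _))).resolve_left (hs i)
  let χ : Γ → Fin t → k := fun g i => (φ (s i) (l (s i)))⁻¹ * φ (s i) (ρ g (l (s i)))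
  have hχ : ∀ g i, ρ g (l (s i)) = χ g i • l (s i) := by
    intro g i
    rw [mul_smul, reflection_comm_eigen (hcomm _ _) (hρ (s i)), smul_smul, inv_mul_cancel₀ (hs i),
      one_smul]
  -- A generator serves as its own witness if it is diagonalizable with direction parallel to `l (s
  -- i)`; otherwise it fixes `l (s i)` and the witness is `1`. The property passes to products and
  -- inverses.
  have hsplit : ∀ g i, ∃ g', ρ g' (l (s i)) = ρ g (l (s i)) ∧
      (∀ j, j ≠ i → ρ g' (l (s j)) = l (s j)) ∧ ∀ y ∈ W', ρ g' y = y := by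
    intro g i
    have hg : g ∈ Subgroup.closure S := hS ▸ Subgroup.mem_top g
    induction hg using Subgroup.closure_induction with
    | mem σ hσ =>
      by_cases h : φ ⟨σ, hσ⟩ (l ⟨σ, hσ⟩) = 0
      · refine ⟨1, ?_, by simp, by simp⟩
        have h1 := hrel (s i) ⟨σ, hσ⟩ (l (s i))
        rw [(hW' _).1 (hMW' (htrans _ h)) i, mul_zero, zero_smul, eq_comm, smul_eq_zero] at h1
        have h2 := (mul_eq_zero.1 (h1.resolve_right (hl _))).resolve_left (hs i)
        have h3 := hρ ⟨σ, hσ⟩ (l (s i))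
        rw [h2, zero_smul, add_zero] at h3
        rw [map_one, Module.End.one_apply]
        exact h3.symm
      · obtain ⟨j, hj, d, hd, hjd⟩ := hpar _ h
        have hfixj : ∀ j', j' ≠ j → ρ σ (l (s j')) = l (s j') := by
          intro j' hj'
          have h1 := hort j' j hj'
          rw [hjd, map_smul, smul_eq_zero] at h1
          have h2 := hfix ⟨σ, hσ⟩ j' h (h1.resolve_left hd)
          have h3 := hρ ⟨σ, hσ⟩ (l (s j'))
          rw [h2, zero_smul, add_zero] at h3
          exact h3
        by_cases hij : i = j
        · subst hij
          refine ⟨σ, rfl, hfixj, fun y hy => ?_⟩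
          have h1 := hrel (s i) ⟨σ, hσ⟩ y
          rw [(hW' y).1 hy i, zero_mul, zero_smul, smul_eq_zero] at h1
          have h2 := (mul_eq_zero.1 (h1.resolve_right (hl _))).resolve_right hj
          have h3 := hρ ⟨σ, hσ⟩ y
          rw [h2, zero_smul, add_zero] at h3
          exact h3
        · exact ⟨1, by rw [hfixj i hij, map_one, Module.End.one_apply], by simp, by simp⟩
    | one => exact ⟨1, rfl, by simp, by simp⟩
    | mul g h _ _ hg hh =>
      obtain ⟨g', hg1, hg2, hg3⟩ := hg
      obtain ⟨h', hh1, hh2, hh3⟩ := hh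
      refine ⟨g' * h', ?_, fun j hj => ?_, fun y hy => ?_⟩
      · rw [map_mul, map_mul, Module.End.mul_apply, Module.End.mul_apply, hh1, hχ, map_smul,
          map_smul, hg1]
      · rw [map_mul, Module.End.mul_apply, hh2 j hj, hg2 j hj]
      · rw [map_mul, Module.End.mul_apply, hh3 y hy, hg3 y hy]
    | inv g _ hg =>
      obtain ⟨g', hg1, hg2, hg3⟩ := hg
      have hfx : ∀ x, ρ g' x = x → ρ g'⁻¹ x = x := by
        intro x hx
        conv_lhs => rw [← hx]
        exact hinv g' x
      refine ⟨g'⁻¹, ?_, fun j hj => hfx _ (hg2 j hj), fun y hy => hfx _ (hg3 y hy)⟩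
      have h1 := hinv g' (l (s i))
      have h2 := hinv g (l (s i))
      rw [hg1, hχ, map_smul] at h1
      rw [hχ, map_smul] at h2
      have h0 : χ g i ≠ 0 := fun h => hl (s i) (by rw [← h2, h, zero_smul])
      exact smul_right_injective W h0 (h1.trans h2.symm)
  -- assembling the basis
  obtain ⟨N₀, hN₀⟩ := Submodule.exists_isCompl M
  -- By the modular law this is a complement of `M` inside `W'`.
  let N : Submodule k W := N₀ ⊓ W'
  have hMN : M ⊔ N = W' := by
    rw [← sup_inf_assoc_of_le N₀ hMW', hN₀.sup_eq_top, top_inf_eq]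
  have hMN' : Disjoint M N := hN₀.disjoint.mono_right inf_le_left
  let bM := Module.finBasis k M
  let bN := Module.finBasis k N
  have hspanM : Submodule.span k (Set.range fun i => (bM i : W)) = M := by
    have := congrArg (Submodule.map M.subtype) bM.span_eq
    rwa [Submodule.map_span, ← Set.range_comp, Submodule.map_subtype_top] at this
  have hspanN : Submodule.span k (Set.range fun i => (bN i : W)) = N := by
    have := congrArg (Submodule.map N.subtype) bN.span_eq
    rwa [Submodule.map_span, ← Set.range_comp, Submodule.map_subtype_top] at this
  let v : (Fin t ⊕ Fin (Module.finrank k M)) ⊕ Fin (Module.finrank k N) → W :=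
    Sum.elim (Sum.elim (fun i => l (s i)) fun i => (bM i : W)) fun i => (bN i : W)
  have hzero : ∀ x ∈ Submodule.span k (Set.range fun i => l (s i)), x ∈ W' → x = 0 := by
    intro x hx hxW
    obtain ⟨c, rfl⟩ := (Submodule.mem_span_range_iff_exists_fun k).1 hx
    refine Finset.sum_eq_zero fun i _ => ?_
    have := (hW' _).1 hxW i
    rw [hsum] at this
    rw [(mul_eq_zero.1 this).resolve_right (hs i), zero_smul]
  have hvli : LinearIndependent k v := by
    refine LinearIndependent.sum_type (LinearIndependent.sum_type hsli
      (bM.linearIndependent.map' M.subtype (by simp)) ?_)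
      (bN.linearIndependent.map' N.subtype (by simp)) ?_
    · rw [Submodule.disjoint_def]
      intro x hx hx'
      refine hzero x hx (hMW' ?_)
      rw [← hspanM]
      exact hx'
    · rw [Submodule.disjoint_def]
      intro x hx hx'
      have hxN : x ∈ N := by rw [← hspanN]; exact hx'
      rw [Set.Sum.elim_range, Submodule.span_union] at hx
      obtain ⟨y, hy, z, hz, rfl⟩ := Submodule.mem_sup.1 hx
      have hzM : z ∈ M := by rw [← hspanM]; exact hz
      have hy0 : y = 0 := by
        refine hzero y hy ?_
        have : y = (y + z) - z := by abel
        rw [this]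
        exact sub_mem hxN.2 (hMW' hzM)
      rw [hy0, zero_add] at hxN ⊢
      exact Submodule.disjoint_def.1 hMN' z hzM hxN
  have hvspan : ⊤ ≤ Submodule.span k (Set.range v) := by
    intro x _
    rw [Set.Sum.elim_range, Set.Sum.elim_range, Submodule.span_union, Submodule.span_union, hspanM,
      hspanN, sup_assoc, hMN]
    have h1 : x = (∑ i, ((φ (s i) (l (s i)))⁻¹ * φ (s i) x) • l (s i)) +
        (x - ∑ i, ((φ (s i) (l (s i)))⁻¹ * φ (s i) x) • l (s i)) := by abel
    rw [h1]
    refine Submodule.add_mem_sup ((Submodule.mem_span_range_iff_exists_fun k).2 ⟨_, rfl⟩) ?_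
    rw [hW']
    intro i
    rw [map_sub, hsum, mul_right_comm, inv_mul_cancel₀ (hs i), one_mul, sub_self]
  refine ⟨t, _, _, Module.Basis.mk hvli hvspan, χ, ?_, ?_, ?_, ?_⟩
  · intro g i
    rw [Module.Basis.mk_apply]
    exact hχ g i
  · intro g i
    rw [Module.Basis.mk_apply]
    exact (hM _).1 (bM i).2 g
  · intro g j
    have h1 := hmove g _ (bN j).2.2
    rw [← hspanM, Submodule.mem_span_range_iff_exists_fun] at h1
    obtain ⟨c, hc⟩ := h1
    refine ⟨c, ?_⟩
    simp only [Module.Basis.mk_apply]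
    change ρ g (bN j : W) = (bN j : W) + ∑ i, c i • (bM i : W)
    rw [hc]
    abel
  · intro g i
    obtain ⟨g', h1, h2, h3⟩ := hsplit g i
    refine ⟨g', ?_, ?_⟩
    · rw [Module.Basis.mk_apply]
      exact h1.trans (hχ g i)
    · rintro ((j | j) | j) hx
      · rw [Module.Basis.mk_apply]
        exact h2 j fun h => hx (by rw [h])
      · rw [Module.Basis.mk_apply]
        exact h3 _ (hMW' (bM j).2)
      · rw [Module.Basis.mk_apply]
        exact h3 _ (bN j).2.2

end AdaptedBasis

/-! ### From the symmetric algebra to polynomials -/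

section Coordinates

variable {k : Type*} [Field k] {V : Type*} [AddCommGroup V] [Module k V] {ι : Type*}

/-- The action of the linear automorphisms of `V` on the dual space. -/
noncomputable def dualRep : (V ≃ₗ[k] V) →* Module.End k (Module.Dual k V) where
  toFun σ := (σ.symm : V →ₗ[k] V).dualMap
  map_one' := rfl
  map_mul' _ _ := rfl

theorem dualRep_apply_apply (σ : V ≃ₗ[k] V) (x : Module.Dual k V) (v : V) :
    dualRep σ x v = x (σ.symm v) := rfl

/-- The action of the linear automorphisms of `V` on polynomials in a basis of linear forms. -/
noncomputable def polyAction (b : Module.Basis ι k (Module.Dual k V)) :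
    (V ≃ₗ[k] V) →* (MvPolynomial ι k →ₐ[k] MvPolynomial ι k) where
  toFun σ := (SymmetricAlgebra.equivMvPolynomial b).toAlgHom.comp
    ((coordAction k V σ).comp (SymmetricAlgebra.equivMvPolynomial b).symm.toAlgHom)
  map_one' := by ext; simp
  map_mul' σ τ := by ext; simp

variable (b : Module.Basis ι k (Module.Dual k V))

theorem polyAction_equiv (σ : V ≃ₗ[k] V) (f : CoordRing k V) :
    polyAction b σ (SymmetricAlgebra.equivMvPolynomial b f) =
      SymmetricAlgebra.equivMvPolynomial b (coordAction k V σ f) := by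
  simp [polyAction]

theorem equivMvPolynomial_ι (x : Module.Dual k V) :
    SymmetricAlgebra.equivMvPolynomial b (SymmetricAlgebra.ι k _ x) = b.constr k X x :=
  SymmetricAlgebra.lift_ι_apply _ _

theorem polyAction_constr (σ : V ≃ₗ[k] V) (x : Module.Dual k V) :
    polyAction b σ (b.constr k X x) = b.constr k X (dualRep σ x) := by
  rw [← equivMvPolynomial_ι, polyAction_equiv, ← equivMvPolynomial_ι]
  exact congrArg _ (SymmetricAlgebra.lift_ι_apply _ _)

theorem polyAction_X (σ : V ≃ₗ[k] V) (i : ι) :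
    polyAction b σ (X i) = b.constr k X (dualRep σ (b i)) := by
  rw [← polyAction_constr, Module.Basis.constr_basis]

theorem constr_X_injective : Function.Injective (b.constr k (X : ι → MvPolynomial ι k)) := by
  classical
  intro x y h
  refine b.ext_elem fun i => ?_
  have hc : ∀ z, coeff (Finsupp.single i 1) (b.constr k (X : ι → MvPolynomial ι k) z) =
      b.repr z i := by
    intro z
    rw [Module.Basis.constr_apply, Finsupp.sum, coeff_sum,
      Finset.sum_eq_single i]
    · simp
    · intro j _ hj
      simp [coeff_X, Finsupp.single_left_inj, hj]
    · intro hi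
      simp [Finsupp.notMem_support_iff.1 hi]
  rw [← hc, h, hc]

theorem mem_homogeneousPart_iff (d : ℕ) (f : CoordRing k V) :
    f ∈ homogeneousPart k V d ↔ (SymmetricAlgebra.equivMvPolynomial b f).IsHomogeneous d := by
  have h1 : (LinearMap.range (SymmetricAlgebra.ι k (Module.Dual k V))).map
      (SymmetricAlgebra.equivMvPolynomial b).toAlgHom.toLinearMap = homogeneousSubmodule ι k 1 := by
    rw [homogeneousSubmodule_one_eq_span_X, ← LinearMap.range_comp,
      ← Module.Basis.constr_range b (S := k)]
    congr 1
    ext x : 1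
    exact equivMvPolynomial_ι b x
  rw [← mem_homogeneousSubmodule, ← homogeneousSubmodule_one_pow, ← h1, ← Submodule.map_pow]
  exact (Function.Injective.mem_set_image (SymmetricAlgebra.equivMvPolynomial b).injective).symm

theorem mem_invariants_iff (G : Subgroup (V ≃ₗ[k] V)) (f : CoordRing k V) :
    f ∈ invariants G ↔ ∀ g : G, polyAction b g (SymmetricAlgebra.equivMvPolynomial b f) =
      SymmetricAlgebra.equivMvPolynomial b f := by
  simp only [polyAction_equiv, EmbeddingLike.apply_eq_iff_eq, Subtype.forall]
  rfl

end Coordinates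

/-! ### Pseudo-reflections on the dual space -/

section PseudoReflection

variable {k : Type*} [Field k] {V : Type*} [AddCommGroup V] [Module k V] [FiniteDimensional k V]

/-- The map `D = τ⁻¹ - 1` has rank one, so `D v = ψ (D v) • w`. Its transpose is `x ↦ x w • (ψ ∘
D)`: the functional is evaluation at `w` and the direction is `ψ ∘ D`. -/
theorem IsPseudoReflection.exists_dualRep {τ : V ≃ₗ[k] V}
    (hτ : IsPseudoReflection (τ : V →ₗ[k] V)) :
    ∃ (φ : Module.Dual k (Module.Dual k V)) (l : Module.Dual k V), φ ≠ 0 ∧ l ≠ 0 ∧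
      ∀ x, dualRep τ x = x + φ x • l := by
  let D : V →ₗ[k] V := (τ.symm : V →ₗ[k] V) - LinearMap.id
  have hD : ∀ v, D v = τ.symm v - v := fun v => rfl
  have hker : LinearMap.ker D = (τ : V →ₗ[k] V).fixedSubmodule := by
    ext v
    rw [LinearMap.mem_ker, LinearMap.mem_fixedSubmodule_iff, hD, sub_eq_zero,
      LinearEquiv.symm_apply_eq, eq_comm]
    rfl
  have hr : Module.finrank k (LinearMap.range D) = 1 := by
    rw [← hτ, ← hker]
    exact D.quotKerEquivRange.finrank_eq.symm
  obtain ⟨⟨w, hw⟩, hw0, hspan⟩ := finrank_eq_one_iff'.1 hr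
  have hw0 : w ≠ 0 := fun h => hw0 (Subtype.ext h)
  obtain ⟨ψ, hψ⟩ : ∃ ψ : Module.Dual k V, ψ w = 1 := by
    obtain ⟨ψ, hψ⟩ := not_forall.1 fun h => hw0 ((Module.forall_dual_apply_eq_zero_iff k w).1 h)
    exact ⟨(ψ w)⁻¹ • ψ, by simp [inv_mul_cancel₀ hψ]⟩
  have hDv : ∀ v, D v = ψ (D v) • w := by
    intro v
    obtain ⟨c, hc⟩ := hspan ⟨D v, v, rfl⟩
    have hc : c • w = D v := congrArg Subtype.val hc
    rw [← hc, map_smul, hψ, smul_eq_mul, mul_one]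
  refine ⟨Module.Dual.eval k V w, ψ ∘ₗ D, ?_, ?_, fun x => ?_⟩
  · intro h
    have := LinearMap.congr_fun h ψ
    simp [hψ] at this
  · intro h
    obtain ⟨v, hv⟩ := hw
    have := LinearMap.congr_fun h v
    rw [LinearMap.comp_apply, hv, hψ] at this
    exact one_ne_zero this
  · ext v
    have := hDv v
    rw [hD, sub_eq_iff_eq_add] at this
    rw [dualRep_apply_apply, this]
    simp [hD, mul_comm, add_comm]

/-- Linear forms cannot distinguish `τ⁻¹ v` from `v` when `l v = 0`, so the fixed space contains the
kernel of `l` and has codimension at most one; `τ ≠ 1` excludes codimension zero. -/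
theorem isPseudoReflection_of_dualRep {τ : V ≃ₗ[k] V} (hτ : τ ≠ 1) (l : Module.Dual k V)
    (h : ∀ x, ∃ c : k, dualRep τ x = x + c • l) : IsPseudoReflection (τ : V →ₗ[k] V) := by
  have hle : LinearMap.ker l ≤ (τ : V →ₗ[k] V).fixedSubmodule := by
    intro v hv
    rw [LinearMap.mem_fixedSubmodule_iff]
    change τ v = v
    rw [eq_comm, ← LinearEquiv.symm_apply_eq, ← sub_eq_zero,
      ← Module.forall_dual_apply_eq_zero_iff k]
    intro x
    obtain ⟨c, hc⟩ := h x
    have := LinearMap.congr_fun hc v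
    rw [dualRep_apply_apply] at this
    simp [this, LinearMap.mem_ker.1 hv]
  refine le_antisymm ?_ ?_
  · refine (LinearMap.finrank_le_finrank_of_surjective (f := Submodule.factor hle)
      (Submodule.factor_surjective hle)).trans ?_
    rw [l.quotKerEquivRange.finrank_eq]
    exact (Submodule.finrank_le _).trans (Module.finrank_self k).le
  · refine Nat.one_le_iff_ne_zero.2 fun h0 => hτ ?_
    rw [Module.finrank_zero_iff, Submodule.Quotient.subsingleton_iff,
      LinearEquiv.fixedSubmodule_eq_top_iff] at h0
    exact h0

end PseudoReflection

/-! ### Reflections and a retraction imply coregularity -/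

section Coregular

variable {k : Type*} [Field k] {V : Type*} [AddCommGroup V] [Module k V]

/-- The invariants in terms of a basis of linear forms. -/
noncomputable def polyInvariants {ι : Type*} (b : Module.Basis ι k (Module.Dual k V))
    (G : Subgroup (V ≃ₗ[k] V)) : Subalgebra k (MvPolynomial ι k) :=
  (invariants G).map (SymmetricAlgebra.equivMvPolynomial b).toAlgHom

theorem equiv_mem_polyInvariants {ι : Type*} (b : Module.Basis ι k (Module.Dual k V))
    (G : Subgroup (V ≃ₗ[k] V)) (f : CoordRing k V) :
    SymmetricAlgebra.equivMvPolynomial b f ∈ polyInvariants b G ↔ f ∈ invariants G :=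
  Function.Injective.mem_set_image (SymmetricAlgebra.equivMvPolynomial b).injective

theorem mem_polyInvariants_iff {ι : Type*} (b : Module.Basis ι k (Module.Dual k V))
    (G : Subgroup (V ≃ₗ[k] V)) (f : MvPolynomial ι k) :
    f ∈ polyInvariants b G ↔ ∀ g : G, (polyAction b).comp G.subtype g f = f := by
  obtain ⟨f, rfl⟩ := (SymmetricAlgebra.equivMvPolynomial b).surjective f
  rw [equiv_mem_polyInvariants, mem_invariants_iff b]
  rfl

theorem isCoregular_iff {ι : Type*} [Finite ι] (b : Module.Basis ι k (Module.Dual k V))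
    [FiniteDimensional k V] (G : Subgroup (V ≃ₗ[k] V)) :
    IsCoregular G ↔ ∃ f : ι → MvPolynomial ι k, (∀ i, ∃ d, (f i).IsHomogeneous d) ∧
      AlgebraicIndependent k f ∧ Algebra.adjoin k (Set.range f) = polyInvariants b G := by
  have := Fintype.ofFinite ι
  have hcard : Fintype.card ι = Module.finrank k V := by
    rw [← Subspace.dual_finrank_eq, Module.finrank_eq_card_basis b]
  let ε : ι ≃ Fin (Module.finrank k V) := Fintype.equivFinOfCardEq hcard
  let e := SymmetricAlgebra.equivMvPolynomial b
  have he : ∀ s : Set (CoordRing k V), Algebra.adjoin k (e '' s) = polyInvariants b G ↔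
      Algebra.adjoin k s = invariants G := by
    intro s
    rw [← (Subalgebra.map_injective e.injective).eq_iff]
    rw [AlgHom.map_adjoin]
    rfl
  constructor
  · rintro ⟨f, -, hf, hai, hgen⟩
    refine ⟨e ∘ f ∘ ε, fun i => ?_, ?_, ?_⟩
    · obtain ⟨d, hd⟩ := hf (ε i)
      exact ⟨d, (mem_homogeneousPart_iff b d _).1 hd⟩
    · exact (hai.comp ε ε.injective).map' (f := e.toAlgHom) e.injective
    · rw [Set.range_comp, he, ε.surjective.range_comp, hgen]
  · rintro ⟨f, hf, hai, hgen⟩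
    have hr : e '' Set.range (e.symm ∘ f ∘ ε.symm) = Set.range f := by
      rw [← Set.range_comp, ← ε.symm.surjective.range_comp f]
      congr 1
      ext : 1
      simp
    have hadj : Algebra.adjoin k (Set.range (e.symm ∘ f ∘ ε.symm)) = invariants G := by
      rw [← he, hr, hgen]
    refine ⟨e.symm ∘ f ∘ ε.symm, fun i => ?_, fun i => ?_, ?_, hadj⟩
    · rw [← hadj]
      exact Algebra.subset_adjoin ⟨i, rfl⟩
    · obtain ⟨d, hd⟩ := hf (ε.symm i)
      refine ⟨d, (mem_homogeneousPart_iff b d _).2 ?_⟩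
      simpa [e] using hd
    · exact (hai.comp ε.symm ε.symm.injective).map' (f := e.symm.toAlgHom) e.symm.injective

/-- A graded map sends `1` to a constant, which surjectivity forces to be nonzero, so it can be
divided out. Conversely, `π 1 = 1` and linearity make `π` the identity on the invariants. -/
theorem directSummandProperty_iff {ι : Type*} (b : Module.Basis ι k (Module.Dual k V))
    (G : Subgroup (V ≃ₗ[k] V)) :
    DirectSummandProperty G ↔ ∃ π : MvPolynomial ι k →+ MvPolynomial ι k,
      (∀ s, π s ∈ polyInvariants b G) ∧ (∀ r ∈ polyInvariants b G, ∀ s, π (r * s) = r * π s) ∧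
      (∀ d s, s.IsHomogeneous d → (π s).IsHomogeneous d) ∧ π 1 = 1 := by
  let e := SymmetricAlgebra.equivMvPolynomial b
  constructor
  · rintro ⟨π, hsurj, hgr⟩
    let π₀ : MvPolynomial ι k →+ MvPolynomial ι k :=
      { toFun := fun f => e (π (e.symm f))
        map_zero' := by simp
        map_add' := by simp }
    have hπ₀ : ∀ f, π₀ f = e (π (e.symm f)) := fun f => rfl
    have hmul : ∀ r ∈ polyInvariants b G, ∀ s, π₀ (r * s) = r * π₀ s := by
      rintro _ ⟨r, hr, rfl⟩ s
      have h := congrArg Subtype.val (π.map_smul (⟨r, hr⟩ : invariants G) (e.symm s))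
      change ((π (r * e.symm s) : invariants G) : CoordRing k V) = r * π (e.symm s) at h
      change π₀ (e r * s) = e r * π₀ s
      rw [hπ₀, hπ₀, map_mul, e.symm_apply_apply, h, map_mul]
    have hhom : ∀ d s, s.IsHomogeneous d → (π₀ s).IsHomogeneous d := by
      intro d s hs
      refine (mem_homogeneousPart_iff b d _).1 (hgr d _ ((mem_homogeneousPart_iff b d _).2 ?_))
      rwa [(SymmetricAlgebra.equivMvPolynomial b).apply_symm_apply]
    have hC : ∀ a : k, C a ∈ polyInvariants b G := fun a => (polyInvariants b G).algebraMap_mem a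
    have h1 := hhom 0 1 (isHomogeneous_one _ _)
    rw [← totalDegree_zero_iff_isHomogeneous, totalDegree_eq_zero_iff_eq_C] at h1
    set c := coeff 0 (π₀ 1)
    have hc : c ≠ 0 := by
      intro hc
      obtain ⟨f, hf⟩ := hsurj 1
      have hf' : π₀ (e f) = 1 := by
        rw [hπ₀, e.symm_apply_apply, hf]
        exact map_one e
      -- Compare components of degree zero: that of `π₀ (e f) = 1` would be a multiple of `π₀ 1 =
      -- 0`.
      have h2 := map_homogeneousComponent hhom (e f) 0
      rw [hf', homogeneousComponent_zero, homogeneousComponent_zero, ← mul_one (C (coeff 0 (e f))),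
        hmul _ (hC _), h1, hc] at h2
      simp at h2
    refine ⟨(AddMonoidHom.mulLeft (C c⁻¹)).comp π₀, fun s => ?_, fun r hr s => ?_,
      fun d s hs => ?_, ?_⟩
    · exact mul_mem (hC _) ((equiv_mem_polyInvariants b G _).2 (π (e.symm s)).2)
    · change C c⁻¹ * π₀ (r * s) = r * (C c⁻¹ * π₀ s)
      rw [hmul r hr, mul_left_comm]
    · exact (hhom d s hs).C_mul _
    · change C c⁻¹ * π₀ 1 = 1
      rw [h1, ← C_mul, inv_mul_cancel₀ hc, C_1]
  · rintro ⟨π, hR, hmul, hhom, h1⟩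
    have hmem : ∀ s, e.symm (π (e s)) ∈ invariants G := by
      intro s
      rw [← equiv_mem_polyInvariants b]
      simpa [e] using hR (e s)
    have hmul' : ∀ (r : invariants G) (s : CoordRing k V),
        e.symm (π (e (r * s))) = r * e.symm (π (e s)) := by
      intro r s
      rw [map_mul, hmul _ ((equiv_mem_polyInvariants b G r).2 r.2), map_mul, e.symm_apply_apply]
    refine ⟨LinearMap.mk (AddHom.mk (fun s => ⟨e.symm (π (e s)), hmem s⟩) fun x y => ?_)
        fun r s => ?_, fun r => ⟨r, ?_⟩, fun d s hs => ?_⟩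
    · apply Subtype.ext; simp
    · exact Subtype.ext (hmul' r s)
    · refine Subtype.ext ?_
      change e.symm (π (e r)) = r
      conv_lhs => rw [← mul_one (r : CoordRing k V)]
      rw [hmul', map_one, h1, map_one, mul_one]
    · rw [mem_homogeneousPart_iff b] at hs ⊢
      have := hhom d _ hs
      change (e (e.symm (π (e s)))).IsHomogeneous d
      rwa [e.apply_symm_apply]

theorem closure_eq_top_of_isPseudoReflectionGroup {G : Subgroup (V ≃ₗ[k] V)}
    (hG : IsPseudoReflectionGroup G) :
    Subgroup.closure {g : G | IsPseudoReflection ((g : V ≃ₗ[k] V) : V →ₗ[k] V)} = ⊤ := by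
  apply Subgroup.map_injective G.subtype_injective
  rw [MonoidHom.map_closure, ← MonoidHom.range_eq_map, Subgroup.range_subtype]
  refine Eq.trans ?_ hG
  congr 1
  ext τ
  constructor
  · rintro ⟨g, hg, rfl⟩
    exact ⟨g.2, hg⟩
  · rintro ⟨h, hτ⟩
    exact ⟨⟨τ, h⟩, hτ, rfl⟩

theorem isPseudoReflectionGroup_of_closure_eq_top {G : Subgroup (V ≃ₗ[k] V)}
    (h : Subgroup.closure {g : G | IsPseudoReflection ((g : V ≃ₗ[k] V) : V →ₗ[k] V)} = ⊤) :
    IsPseudoReflectionGroup G := by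
  have h' := congrArg (Subgroup.map G.subtype) h
  rw [MonoidHom.map_closure, ← MonoidHom.range_eq_map, Subgroup.range_subtype] at h'
  refine Eq.trans ?_ h'
  congr 1
  ext τ
  constructor
  · rintro ⟨h, hτ⟩
    exact ⟨⟨τ, h⟩, hτ, rfl⟩
  · rintro ⟨g, hg, rfl⟩
    exact ⟨g.2, hg⟩

theorem isCoregular_of_isPseudoReflectionGroup [FiniteDimensional k V]
    {G : Subgroup (V ≃ₗ[k] V)} [Finite G] (hG : ∀ σ ∈ G, ∀ τ ∈ G, σ * τ = τ * σ)
    (hrefl : IsPseudoReflectionGroup G) (hds : DirectSummandProperty G) : IsCoregular G := by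
  obtain ⟨t, m, u, b, χ, hT, hM, hY, hsplit⟩ := exists_adapted_basis
    (dualRep.comp G.subtype) (fun g h => by
      rw [← map_mul, ← map_mul, show g * h = h * g from Subtype.ext (hG g g.2 h h.2)])
    (closure_eq_top_of_isPseudoReflectionGroup hrefl)
    fun τ hτ => IsPseudoReflection.exists_dualRep hτ
  obtain ⟨π, hπR, hπmul, -, hπ1⟩ := (directSummandProperty_iff b G).1 hds
  have hX : ∀ (g : G) x, (polyAction b).comp G.subtype g (X x) =
    b.constr k X (dualRep.comp G.subtype g (b x)) := fun g x => polyAction_X b g x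
  have hb : ∀ x, b.constr k X (b x) = (X x : MvPolynomial _ k) := b.constr_basis k X
  obtain ⟨f, hf, hadj⟩ := exists_generators_of_coordinates ((polyAction b).comp G.subtype) (χ := χ)
    (fun g i => by rw [hX, hT, map_smul, hb, smul_eq_C_mul])
    (fun g i => by rw [hX, hM, hb])
    (fun g j => by
      obtain ⟨c, hc⟩ := hY g j
      exact ⟨c, by simp only [hX, hc, map_add, map_sum, map_smul, hb, smul_eq_C_mul]⟩)
    (fun g i => by
      obtain ⟨g', h1, h2⟩ := hsplit g i
      exact ⟨g', by rw [hX, h1, map_smul, hb, smul_eq_C_mul],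
        fun x hx => by rw [hX, h2 x hx, hb]⟩)
    (mem_polyInvariants_iff b G) π hπR hπmul hπ1
  have := isIntegral_of_fixed _ (mem_polyInvariants_iff b G)
  exact (isCoregular_iff b G).2 ⟨f, hf, algebraicIndependent_of_adjoin_eq hadj, hadj⟩

end Coregular

end AbelianCoregular

/-! ### Regular sequences over Noetherian local rings -/

namespace RingTheory.Sequence

open Ideal

/-- A coset of an ideal is not covered by finitely many primes unless the ideal it generates lies
in one of them. -/
theorem exists_add_notMem_of_not_span_sup_le {O : Type*} [CommRing O] (x : O) (I : Ideal O)
    (S : Finset (Ideal O)) (hp : ∀ p ∈ S, p.IsPrime) (h : ∀ p ∈ S, ¬ span {x} ⊔ I ≤ p) :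
    ∃ c ∈ I, ∀ p ∈ S, x + c ∉ p := by
  classical
  induction S using Finset.strongInduction with
  | H S ih =>
  rcases S.eq_empty_or_nonempty with rfl | hne
  · exact ⟨0, I.zero_mem, by simp⟩
  -- No other prime of `S` lies below a minimal `p`, so some element of `I` lies in all the others
  -- but not in `p`; it corrects the choice at `p` alone.
  obtain ⟨p, hpS, hmin⟩ := S.exists_minimal hne
  obtain ⟨c, hcI, hc⟩ := ih (S.erase p) (Finset.erase_ssubset hpS)
    (fun q hq => hp q (Finset.mem_of_mem_erase hq)) fun q hq => h q (Finset.mem_of_mem_erase hq)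
  by_cases hxc : x + c ∈ p
  · have hIp : ¬ I ≤ p := by
      refine fun hI => h p hpS (sup_le ((span_singleton_le_iff_mem p).2 ?_) hI)
      exact (add_mem_cancel_right (hI hcI)).1 hxc
    have : ¬ I ⊓ (S.erase p).inf id ≤ p := by
      rw [(hp p hpS).inf_le, not_or, (hp p hpS).inf_le']
      refine ⟨hIp, ?_⟩
      rintro ⟨q, hq, hqp⟩
      exact (Finset.ne_of_mem_erase hq) (le_antisymm hqp (hmin (Finset.mem_of_mem_erase hq) hqp))
    obtain ⟨d, ⟨hdI, hdS⟩, hdp⟩ := SetLike.not_le_iff_exists.1 this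
    refine ⟨c + d, add_mem hcI hdI, fun q hq hmem => ?_⟩
    rw [← add_assoc] at hmem
    by_cases hqp : q = p
    · subst hqp
      exact hdp ((add_mem_cancel_left hxc).1 hmem)
    · have hq' := Finset.mem_erase.2 ⟨hqp, hq⟩
      have hdq : d ∈ q := (Finset.inf_le (f := id) hq' : (S.erase p).inf id ≤ q) hdS
      exact hc q hq' ((add_mem_cancel_right hdq).1 hmem)
  · refine ⟨c, hcI, fun q hq => ?_⟩
    by_cases hqp : q = p
    · rwa [hqp]
    · exact hc q (Finset.mem_erase.2 ⟨hqp, hq⟩)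

/-- In a Noetherian local ring, a sequence as long as a regular sequence whose members have powers
in the ideal which it generates is itself regular. -/
theorem isWeaklyRegular_of_pow_mem {O : Type*} [CommRing O] [IsLocalRing O] [IsNoetherianRing O]
    (n : ℕ) : ∀ (M : Type*) [AddCommGroup M] [Module O M] [Module.Finite O M] (xs fs : List O),
    xs.length = n → fs.length = n → (∀ x ∈ xs, x ∈ IsLocalRing.maximalIdeal O) →
    (∀ f ∈ fs, f ∈ IsLocalRing.maximalIdeal O) → IsWeaklyRegular M xs →
    (∀ x ∈ xs, ∃ N, x ^ N ∈ ofList fs ⊔ Module.annihilator O M) → IsWeaklyRegular M fs := by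
  induction n with
  | zero =>
    intro M _ _ _ xs fs _ hfs _ _ _ _
    rw [List.length_eq_zero_iff.1 hfs]
    exact IsWeaklyRegular.nil O M
  | succ n ih =>
    intro M _ _ _ xs fs hxs hfs hxm hfm hreg hpow
    obtain ⟨f, fs, rfl⟩ := List.exists_cons_of_length_eq_add_one hfs
    obtain ⟨xs, y, rfl⟩ : ∃ xs' y, xs = xs' ++ [y] := by
      rcases xs.eq_nil_or_concat' with rfl | h
      · simp at hxs
      · exact h
    rw [isWeaklyRegular_append_iff, isWeaklyRegular_singleton_iff] at hreg
    obtain ⟨hxs_reg, hy⟩ := hreg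
    set N := M ⧸ (ofList xs • ⊤ : Submodule O M) with hN
    have hfin : (associatedPrimes O N).Finite := associatedPrimes.finite O N
    -- An associated prime of `N` containing `f` and `fs` would contain a power of `y`, which is
    -- regular on `N`. Hence `f` can be altered modulo `fs` to be regular on `N`, and so can replace
    -- `y`.
    obtain ⟨c, hc, hcp⟩ := exists_add_notMem_of_not_span_sup_le f (ofList fs) hfin.toFinset
      (fun p hp => ((hfin.mem_toFinset).1 hp).isPrime) (by
        intro p hp hle
        rw [hfin.mem_toFinset] at hp
        have hprime : p.IsPrime := hp.isPrime
        have hann : Module.annihilator O M ≤ p := by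
          refine le_trans ?_ hp.annihilator_le
          rw [Submodule.annihilator_top]
          exact (Submodule.mkQ (ofList xs • ⊤ : Submodule O M)).annihilator_le_of_surjective (
            Submodule.mkQ_surjective _)
        obtain ⟨e, he⟩ := hpow y (by simp)
        rw [ofList_cons] at he
        have hyp : y ∈ p := hprime.mem_of_pow_mem e (sup_le hle hann he)
        have : y ∈ ⋃ p ∈ associatedPrimes O N, (p : Set O) := Set.mem_biUnion hp hyp
        rw [biUnion_associatedPrimes_eq_compl_regular] at this
        exact this hy)
    have hz : IsSMulRegular N (f + c) := by
      by_contra hz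
      have : f + c ∈ ⋃ p ∈ associatedPrimes O N, (p : Set O) := by
        rw [biUnion_associatedPrimes_eq_compl_regular]
        exact hz
      obtain ⟨p, hp, hmem⟩ := Set.mem_iUnion₂.1 this
      exact hcp p (hfin.mem_toFinset.2 hp) hmem
    have hfs_le : ofList fs ≤ IsLocalRing.maximalIdeal O :=
      span_le.2 fun x hx => hfm x (List.mem_cons_of_mem _ hx)
    have hzm : f + c ∈ IsLocalRing.maximalIdeal O := add_mem (hfm f (by simp)) (hfs_le hc)
    have h1 : IsWeaklyRegular M ((f + c) :: xs) := by
      refine IsLocalRing.isWeaklyRegular_of_perm_of_subset_maximalIdeal (rs := xs ++ [f + c]) ?_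
        (List.perm_append_singleton _ _) ?_
      · rw [isWeaklyRegular_append_iff, isWeaklyRegular_singleton_iff]
        exact ⟨hxs_reg, hz⟩
      · intro x hx
        rcases List.mem_append.1 hx with hx | hx
        · exact hxm x (by simp [hx])
        · rw [List.mem_singleton.1 hx]
          exact hzm
    rw [isWeaklyRegular_cons_iff] at h1
    -- Here `f + c` annihilates the module, so `f` is redundant modulo `fs` and the annihilator.
    have h2 : IsWeaklyRegular (QuotSMulTop (f + c) M) fs := by
      refine ih _ xs fs (by simpa using hxs) (by simpa using hfs)
        (fun x hx => hxm x (by simp [hx])) (fun x hx => hfm x (by simp [hx])) h1.2 fun x hx => ?_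
      obtain ⟨e, he⟩ := hpow x (by simp [hx])
      suffices hle : ofList (f :: fs) ⊔ Module.annihilator O M ≤
          ofList fs ⊔ Module.annihilator O (QuotSMulTop (f + c) M) from ⟨e, hle he⟩
      refine sup_le ?_ ?_
      · rw [ofList_cons]
        refine sup_le ((span_singleton_le_iff_mem _).2 ?_) le_sup_left
        suffices hf : f + c - c ∈ ofList fs ⊔ Module.annihilator O (QuotSMulTop (f + c) M) by
          rwa [add_sub_cancel_right] at hf
        refine sub_mem (mem_sup_right ?_) (mem_sup_left hc)
        rw [Module.mem_annihilator]
        intro m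
        obtain ⟨m, rfl⟩ := Submodule.mkQ_surjective _ m
        rw [← map_smul, Submodule.mkQ_apply, Submodule.Quotient.mk_eq_zero]
        exact Submodule.smul_mem_pointwise_smul _ _ _ Submodule.mem_top
      · exact le_sup_of_le_right
          ((Submodule.mkQ _).annihilator_le_of_surjective (Submodule.mkQ_surjective _))
    have h3 : IsWeaklyRegular M (fs ++ [f + c]) := by
      refine IsLocalRing.isWeaklyRegular_of_perm_of_subset_maximalIdeal (rs := (f + c) :: fs)
        ((isWeaklyRegular_cons_iff _ _ _).2 ⟨h1.1, h2⟩) (List.perm_append_singleton _ _).symm ?_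
      intro x hx
      rcases List.mem_cons.1 hx with rfl | hx
      · exact hzm
      · exact hfm x (by simp [hx])
    rw [isWeaklyRegular_append_iff, isWeaklyRegular_singleton_iff] at h3
    have h4 : IsWeaklyRegular M (fs ++ [f]) := by
      rw [isWeaklyRegular_append_iff, isWeaklyRegular_singleton_iff]
      refine ⟨h3.1, fun a b hab => h3.2 ?_⟩
      have hc0 : ∀ a : M ⧸ (ofList fs • ⊤ : Submodule O M), c • a = 0 := by
        intro a
        obtain ⟨a, rfl⟩ := Submodule.mkQ_surjective _ a
        rw [← map_smul, Submodule.mkQ_apply, Submodule.Quotient.mk_eq_zero]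
        exact Submodule.smul_mem_smul hc Submodule.mem_top
      simpa [add_smul, hc0] using hab
    refine IsLocalRing.isWeaklyRegular_of_perm_of_subset_maximalIdeal h4
      (List.perm_append_singleton _ _) ?_
    intro x hx
    refine hfm x ?_
    simpa [or_comm] using hx

theorem isWeaklyRegular_self_iff {A : Type*} [CommRing A] (rs : List A) :
    IsWeaklyRegular A rs ↔ ∀ (i : ℕ) (h : i < rs.length) (a : A),
      rs[i] * a ∈ Ideal.ofList (rs.take i) → a ∈ Ideal.ofList (rs.take i) := by
  rw [isWeaklyRegular_iff]
  refine forall₂_congr fun i h => ?_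
  rw [isSMulRegular_quotient_iff_mem_of_smul_mem]
  simp only [smul_eq_mul, Ideal.mul_top]

end RingTheory.Sequence

namespace MvPolynomial

open RingTheory.Sequence
open scoped Pointwise

/-! ### Homogeneous systems of parameters are regular -/

section Regular

variable {k : Type*} [Field k] {σ : Type*}

theorem homogeneousComponent_mem_span {s : Set (MvPolynomial σ k)}
    (hs : ∀ f ∈ s, ∃ d, f.IsHomogeneous d) {g : MvPolynomial σ k} (hg : g ∈ Ideal.span s) (d : ℕ) :
    homogeneousComponent d g ∈ Ideal.span s := by
  let _ : GradedAlgebra (homogeneousSubmodule σ k) := gradedAlgebra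
  exact homogeneousComponent_mem_of_mem
    (Ideal.homogeneous_span (homogeneousSubmodule σ k) s fun f hf => hs f hf) hg d

/-- Modulo a homogeneous ideal a polynomial with non-zero constant term is not a zero divisor. -/
theorem mem_span_of_mul_mem {s : Set (MvPolynomial σ k)} (hs : ∀ f ∈ s, ∃ d, f.IsHomogeneous d)
    {c g : MvPolynomial σ k} (hc : constantCoeff c ≠ 0) (h : c * g ∈ Ideal.span s) :
    g ∈ Ideal.span s := by
  refine mem_of_homogeneousComponent_mem fun d => ?_
  induction d using Nat.strong_induction_on with
  | _ d ih =>
  have h1 := homogeneousComponent_mem_span hs h d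
  rw [mul_comm] at h1
  conv at h1 => rw [← sum_homogeneousComponent c, Finset.mul_sum, map_sum, Finset.sum_range_succ']
  have h2 : homogeneousComponent d (g * homogeneousComponent 0 c) =
      homogeneousComponent d g * C (constantCoeff c) := by
    have := homogeneousComponent_add_mul (homogeneousComponent_isHomogeneous 0 c) g d
    rw [add_zero] at this
    rw [this, homogeneousComponent_zero]
    rfl
  have h3 : ∑ i ∈ Finset.range c.totalDegree,
      homogeneousComponent d (g * homogeneousComponent (i + 1) c) ∈ Ideal.span s := by
    refine Ideal.sum_mem _ fun i _ => ?_
    rcases lt_or_ge d (i + 1) with hd | hd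
    · rw [homogeneousComponent_mul_of_lt (homogeneousComponent_isHomogeneous _ c) g hd]
      exact zero_mem _
    · obtain ⟨e, rfl⟩ := Nat.exists_eq_add_of_le' hd
      rw [homogeneousComponent_add_mul (homogeneousComponent_isHomogeneous _ c)]
      exact Ideal.mul_mem_right _ _ (ih e (by omega))
  rw [h2, Submodule.add_mem_iff_right _ h3] at h1
  have := Ideal.mul_mem_right (C (constantCoeff c)⁻¹) _ h1
  rwa [mul_assoc, ← C_mul, mul_inv_cancel₀ hc, C_1, mul_one] at this

theorem isWeaklyRegular_ofFn_X (n : ℕ) :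
    IsWeaklyRegular (MvPolynomial (Fin n) k)
      (List.ofFn (X : Fin n → MvPolynomial (Fin n) k)) := by
  classical
  rw [isWeaklyRegular_self_iff]
  intro i hi a ha
  rw [List.length_ofFn] at hi
  have hJ : Ideal.ofList ((List.ofFn (X : Fin n → MvPolynomial (Fin n) k)).take i) =
      Ideal.span (X '' {j : Fin n | (j : ℕ) < i}) := by
    refine congrArg Ideal.span ?_
    ext f
    rw [Set.mem_ofPred_eq, List.mem_take_iff_getElem]
    constructor
    · rintro ⟨j, hj, rfl⟩
      rw [List.length_ofFn, lt_min_iff] at hj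
      exact ⟨⟨j, hj.2⟩, hj.1, by simp⟩
    · rintro ⟨j, hj, rfl⟩
      exact ⟨j, by simpa using hj, by simp⟩
  rw [hJ, mem_ideal_span_X_image] at ha ⊢
  intro m hm
  obtain ⟨j, hj, hj0⟩ := ha (m + Finsupp.single ⟨i, hi⟩ 1) (by
    rw [List.getElem_ofFn, mem_support_iff, mul_comm, coeff_mul_X]
    exact mem_support_iff.1 hm)
  refine ⟨j, hj, ?_⟩
  have hne : (⟨i, hi⟩ : Fin n) ≠ j := by
    rintro rfl
    exact lt_irrefl i hj
  simpa [hne] using hj0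

/-- As many forms of positive degree as there are variables, generating an ideal which contains a
power of every variable, are a regular sequence. -/
theorem isWeaklyRegular_ofFn_of_pow_mem {n : ℕ} {f : Fin n → MvPolynomial (Fin n) k}
    (hf : ∀ i, ∃ d, (f i).IsHomogeneous d) (hf0 : ∀ i, constantCoeff (f i) = 0)
    (hpow : ∀ i, ∃ N, X i ^ N ∈ Ideal.span (Set.range f)) :
    IsWeaklyRegular (MvPolynomial (Fin n) k) (List.ofFn f) := by
  let m : Ideal (MvPolynomial (Fin n) k) := RingHom.ker constantCoeff
  have hm : m.IsPrime := RingHom.ker_isPrime _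
  -- At the origin the local criterion compares `f` with the variables. Denominators have nonzero
  -- constant term, so they cancel modulo homogeneous ideals on the way back.
  let O := Localization.AtPrime m
  have hmem : ∀ g : MvPolynomial (Fin n) k, constantCoeff g = 0 →
      algebraMap _ O g ∈ IsLocalRing.maximalIdeal O := fun g hg =>
    (IsLocalization.AtPrime.to_map_mem_maximal_iff O m g).2 hg
  have hX := IsWeaklyRegular.of_isLocalization O m.primeCompl (isWeaklyRegular_ofFn_X (k := k) n)
  have hspan : ∀ l : List (MvPolynomial (Fin n) k),
      Ideal.ofList (l.map (algebraMap _ O)) = (Ideal.ofList l).map (algebraMap _ O) :=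
    fun l => (Ideal.map_ofList _ l).symm
  have hrange : Ideal.ofList (List.ofFn f) = Ideal.span (Set.range f) :=
    congrArg Ideal.span (Set.ext fun g => List.mem_ofFn)
  have hreg := isWeaklyRegular_of_pow_mem n O _ ((List.ofFn f).map (algebraMap _ O)) (by simp)
    (by simp) (by
      intro x hx
      simp only [List.mem_map, List.mem_ofFn] at hx
      obtain ⟨_, ⟨i, rfl⟩, rfl⟩ := hx
      exact hmem _ (constantCoeff_X k _)) (by
      intro x hx
      simp only [List.mem_map, List.mem_ofFn] at hx
      obtain ⟨_, ⟨i, rfl⟩, rfl⟩ := hx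
      exact hmem _ (hf0 i)) hX (by
      intro x hx
      simp only [List.mem_map, List.mem_ofFn] at hx
      obtain ⟨_, ⟨i, rfl⟩, rfl⟩ := hx
      obtain ⟨N, hN⟩ := hpow i
      refine ⟨N, Ideal.mem_sup_left ?_⟩
      rw [hspan, hrange, ← map_pow]
      exact Ideal.mem_map_of_mem _ hN)
  rw [isWeaklyRegular_self_iff] at hreg ⊢
  intro i hi a ha
  have h1 := hreg i (by simpa using hi) (algebraMap _ O a) (by
    rw [List.getElem_map, ← map_mul, ← List.map_take, hspan]
    exact Ideal.mem_map_of_mem _ ha)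
  rw [← List.map_take, hspan,
    IsLocalization.algebraMap_mem_map_algebraMap_iff m.primeCompl] at h1
  obtain ⟨c, hc, hca⟩ := h1
  refine mem_span_of_mul_mem ?_ hc hca
  intro g hg
  obtain ⟨i, rfl⟩ := List.mem_ofFn.1 (List.mem_of_mem_take hg)
  exact hf i

end Regular

/-! ### Independence over a regular sequence -/

section Independence

/-- A family which is linearly independent modulo a regular sequence is linearly independent over
the polynomials in the members of the sequence. -/
theorem eq_zero_of_sum_aeval_smul_eq_zero {k A : Type*} [Field k] [CommRing A] [Algebra k A]
    {ι : Type*} {n : ℕ} : ∀ (M : Type*) [AddCommGroup M] [Module A M] (f : Fin n → A),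
    IsWeaklyRegular M (List.ofFn f) → ∀ b : ι → M,
    (∀ c : ι →₀ k, c.sum (fun i a => algebraMap k A a • b i) ∈
      (Ideal.ofList (List.ofFn f) • ⊤ : Submodule A M) → c = 0) →
    ∀ p : ι →₀ MvPolynomial (Fin n) k, p.sum (fun i q => aeval f q • b i) = 0 → p = 0 := by
  classical
  induction n with
  | zero =>
    intro M _ _ f _ b hb p hp
    have hC : ∀ q : MvPolynomial (Fin 0) k, q = C (coeff 0 q) := eq_C_of_isEmpty
    have : p.mapRange (coeff 0) (coeff_zero 0) = 0 := by
      refine hb _ ?_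
      rw [Finsupp.sum_mapRange_index (by simp)]
      refine (congrArg (· ∈ _) (Eq.trans ?_ hp)).mpr (zero_mem _)
      refine Finsupp.sum_congr fun i _ => ?_
      conv_rhs => rw [hC (p i), aeval_C]
    ext1 i
    have h := DFunLike.congr_fun this i
    rw [Finsupp.mapRange_apply, Finsupp.zero_apply] at h
    rw [hC (p i), h, C_0, Finsupp.zero_apply]
  | succ n ih =>
    intro M _ _ f hf b hb
    rw [List.ofFn_succ, isWeaklyRegular_cons_iff] at hf
    have key := ih (QuotSMulTop (f 0) M) (fun i => f i.succ) hf.2 (Submodule.mkQ _ ∘ b) (by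
      intro c hc
      refine hb c ?_
      have hc' : c.sum (fun i a => algebraMap k A a • b i) ∈
          (Ideal.ofList (List.ofFn fun i : Fin n => f i.succ) •
            (⊤ : Submodule A (QuotSMulTop (f 0) M))).comap (Submodule.mkQ _) := by
        rw [Submodule.mem_comap, Finsupp.sum, map_sum]
        exact hc
      rw [Submodule.comap_smul_top_of_surjective _ _ (Submodule.mkQ_surjective _),
        Submodule.ker_mkQ] at hc'
      rw [List.ofFn_succ, Ideal.ofList_cons_smul, sup_comm]
      exact hc')
    -- Modulo `f 0` the case of `n` elements kills the part of each `p i` free of `X 0`. So `X 0`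
    -- divides all `p i`, regularity of `f 0` cancels it from the relation, and degrees drop.
    suffices H : ∀ (D : ℕ) (p : ι →₀ MvPolynomial (Fin (n + 1)) k),
        (∀ i, p i ≠ 0 → (p i).totalDegree < D) → p.sum (fun i q => aeval f q • b i) = 0 → p = 0 by
      intro p
      refine H (p.support.sup (fun i => (p i).totalDegree) + 1) p fun i hi => ?_
      exact Nat.lt_succ_of_le (Finset.le_sup (f := fun i => (p i).totalDegree)
        (Finsupp.mem_support_iff.2 hi))
    intro D
    induction D with
    | zero =>
      intro p hp _
      ext1 i
      by_contra h
      exact Nat.not_lt_zero _ (hp i h)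
    | succ D ihD =>
      intro p hp hsum
      -- setting the first variable to zero
      let ψ : MvPolynomial (Fin (n + 1)) k →ₐ[k] MvPolynomial (Fin n) k :=
        aeval (Fin.cases 0 X)
      have hψ : ∀ q, ∃ r, q = X 0 * r + rename Fin.succ (ψ q) := by
        intro q
        induction q using MvPolynomial.induction_on with
        | C a => exact ⟨0, by simp [ψ]⟩
        | add q r hq hr =>
          obtain ⟨q', hq⟩ := hq
          obtain ⟨r', hr⟩ := hr
          refine ⟨q' + r', ?_⟩
          conv_lhs => rw [hq, hr]
          simp only [map_add]
          ring
        | mul_X q i hq =>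
          obtain ⟨q', hq⟩ := hq
          cases i using Fin.cases with
          | zero => exact ⟨q, by simp [ψ, mul_comm]⟩
          | succ i =>
            refine ⟨q' * X i.succ, ?_⟩
            conv_lhs => rw [hq]
            simp only [map_mul, ψ, aeval_X, Fin.cases_succ, rename_X]
            ring
      have hmk : ∀ m : M, Submodule.mkQ (f 0 • (⊤ : Submodule A M)) (f 0 • m) = 0 := by
        intro m
        rw [Submodule.mkQ_apply, Submodule.Quotient.mk_eq_zero]
        exact Submodule.smul_mem_pointwise_smul _ _ _ Submodule.mem_top
      have h0 : p.mapRange ψ (map_zero ψ) = 0 := by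
        refine key _ ?_
        rw [Finsupp.sum_mapRange_index (by simp)]
        have h2 := congrArg (Submodule.mkQ (f 0 • (⊤ : Submodule A M))) hsum
        rw [Finsupp.sum, map_sum, map_zero] at h2
        rw [← h2, Finsupp.sum]
        refine Finset.sum_congr rfl fun i _ => ?_
        obtain ⟨r, hr⟩ := hψ (p i)
        conv_rhs => rw [hr]
        rw [map_add, map_mul, aeval_X, add_smul, map_add, mul_smul, hmk, zero_add, aeval_rename,
          map_smul]
        rfl
      have h1 : ∀ i, ∃ r, p i = X 0 * r := by
        intro i
        obtain ⟨r, hr⟩ := hψ (p i)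
        have h := DFunLike.congr_fun h0 i
        rw [Finsupp.mapRange_apply, Finsupp.zero_apply] at h
        exact ⟨r, by rw [hr, h, map_zero, add_zero]⟩
      choose r hr using h1
      have hr0 : ∀ i, r i ≠ 0 ↔ p i ≠ 0 := fun i => by
        rw [hr i, mul_ne_zero_iff, and_iff_right (X_ne_zero _)]
      let q : ι →₀ MvPolynomial (Fin (n + 1)) k :=
        Finsupp.ofSupportFinite r ((p.hasFiniteSupport).subset fun i hi => (hr0 i).1 hi)
      have hq : q = 0 := by
        refine ihD q (fun i hi => ?_) (hf.1 ?_)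
        · have := hp i ((hr0 i).1 hi)
          rw [hr i, totalDegree_mul_of_isDomain (X_ne_zero _) (show r i ≠ 0 from hi),
            totalDegree_X] at this
          change (r i).totalDegree < D
          omega
        · change f 0 • q.sum _ = f 0 • (0 : M)
          rw [smul_zero, ← hsum, Finsupp.sum, Finsupp.sum, Finset.smul_sum]
          have hs : q.support = p.support := by
            ext i
            rw [Finsupp.mem_support_iff, Finsupp.mem_support_iff]
            exact hr0 i
          rw [hs]
          refine Finset.sum_congr rfl fun i _ => ?_
          rw [hr i, map_mul, aeval_X, mul_smul]
          rfl
      ext1 i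
      by_contra h
      exact (hr0 i).2 h (DFunLike.congr_fun hq i)

end Independence

/-! ### Freeness and the graded retraction -/

section Retraction

variable {k : Type*} [Field k] {n : ℕ}

/-- There are monomials, among them `1`, forming a basis of the polynomial ring over the subalgebra
generated by forms of positive degree which are a homogeneous system of parameters. -/
theorem exists_basis_monomial {f : Fin n → MvPolynomial (Fin n) k}
    (hf : ∀ i, ∃ d, (f i).IsHomogeneous d) (hf0 : ∀ i, constantCoeff (f i) = 0)
    (hpow : ∀ i, ∃ N, X i ^ N ∈ Ideal.span (Set.range f)) :
    ∃ (B : Set (Fin n →₀ ℕ))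
      (b : Module.Basis B (Algebra.adjoin k (Set.range f)) (MvPolynomial (Fin n) k)),
      0 ∈ B ∧ ∀ i, b i = monomial i.1 1 := by
  classical
  set I := Ideal.span (Set.range f) with hI
  have hrange : Ideal.ofList (List.ofFn f) = I :=
    congrArg Ideal.span (Set.ext fun g => List.mem_ofFn)
  have hIc : I ≤ RingHom.ker constantCoeff := by
    rw [hI, Ideal.span_le]
    rintro _ ⟨i, rfl⟩
    exact hf0 i
  let v : (Fin n →₀ ℕ) → MvPolynomial (Fin n) k ⧸ I.restrictScalars k :=
    fun m => Submodule.mkQ _ (monomial m 1)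
  have hv0 : LinearIndepOn k v {0} := by
    rw [linearIndepOn_singleton_iff]
    intro h
    change Submodule.mkQ _ _ = 0 at h
    rw [Submodule.mkQ_apply, Submodule.Quotient.mk_eq_zero] at h
    have := hIc h
    rw [RingHom.mem_ker, constantCoeff_monomial, if_pos rfl] at this
    exact one_ne_zero this
  -- Monomials whose classes form a `k`-basis modulo the parameters, chosen to include `1`.
  -- Regularity will lift independence; graded Nakayama, by induction on degree, will lift spanning.
  obtain ⟨B, -, hB0, hspan, hli⟩ := exists_linearIndepOn_extension hv0 (Set.subset_univ _)
  let b : B → MvPolynomial (Fin n) k := fun i => monomial i.1 1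
  set R := Algebra.adjoin k (Set.range f) with hR
  have hRf : R = (aeval f).range := Algebra.adjoin_range_eq_range_aeval k f
  have hLI : LinearIndependent R b := by
    rw [linearIndependent_iff]
    intro l hl
    have hex : ∀ i, ∃ q : MvPolynomial (Fin n) k, aeval f q = (l i : MvPolynomial (Fin n) k) := by
      intro i
      have : (l i : MvPolynomial (Fin n) k) ∈ (aeval (R := k) f).range := hRf ▸ (l i).2
      exact this
    choose q hq using hex
    let p : B →₀ MvPolynomial (Fin n) k := Finsupp.onFinset l.support
      (fun i => if l i = 0 then 0 else q i) fun i hi => by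
        rw [Finsupp.mem_support_iff]
        intro h
        simp [h] at hi
    have hp : ∀ i, aeval f (p i) = (l i : MvPolynomial (Fin n) k) := by
      intro i
      change aeval f (if l i = 0 then 0 else q i) = _
      split_ifs with h
      · rw [h, map_zero]; rfl
      · exact hq i
    have h0 := eq_zero_of_sum_aeval_smul_eq_zero (MvPolynomial (Fin n) k) f
      (isWeaklyRegular_ofFn_of_pow_mem hf hf0 hpow) b (k := k) (by
        intro c hc
        rw [hrange, smul_eq_mul, Ideal.mul_top] at hc
        refine linearIndependent_iff.1 hli c ?_
        rw [Finsupp.linearCombination_apply, Finsupp.sum]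
        change ∑ i ∈ c.support, c i • Submodule.mkQ _ (b i) = 0
        simp_rw [← map_smul]
        rw [← map_sum, Submodule.mkQ_apply, Submodule.Quotient.mk_eq_zero]
        change _ ∈ I
        convert hc using 1
        refine Finset.sum_congr rfl fun i _ => ?_
        exact smul_eq_C_mul _ _) p (by
        rw [← hl, Finsupp.linearCombination_apply]
        unfold Finsupp.sum
        rw [Finset.sum_subset (s₂ := l.support) Finsupp.support_onFinset_subset]
        · refine Finset.sum_congr rfl fun i _ => ?_
          exact congrArg (· • b i) (hp i)
        · intro i _ hi
          have h : p i = 0 := Finsupp.notMem_support_iff.1 hi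
          change aeval f (p i) • b i = 0
          rw [h, map_zero, zero_smul])
    ext1 i
    refine Subtype.ext ?_
    rw [← hp, h0]
    exact map_zero _
  have hT : ∀ d s, s.IsHomogeneous d → s ∈ Submodule.span R (Set.range b) := by
    intro d
    induction d using Nat.strong_induction_on with
    | _ d ih =>
    intro s hs
    have h1 : Submodule.mkQ (I.restrictScalars k) s ∈ Submodule.span k (v '' B) := by
      have hs' : s ∈ Submodule.span k (Set.range fun m : Fin n →₀ ℕ => monomial m (1 : k)) := by
        have := (basisMonomials (Fin n) k).mem_span s
        rwa [coe_basisMonomials] at this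
      have h2 := Submodule.mem_map_of_mem (f := Submodule.mkQ (I.restrictScalars k)) hs'
      rw [Submodule.map_span, ← Set.range_comp] at h2
      refine Submodule.span_le.2 ?_ h2
      rw [← Set.image_univ]
      exact hspan
    have h2 : v '' B = Submodule.mkQ (I.restrictScalars k) '' Set.range b := by
      rw [← Set.range_comp, Set.image_eq_range]
      rfl
    rw [h2, ← Submodule.map_span] at h1
    obtain ⟨t, ht, hts⟩ := h1
    have hst : s - t ∈ I := by
      rw [← sub_eq_zero, ← map_sub, Submodule.mkQ_apply, Submodule.Quotient.mk_eq_zero] at hts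
      rw [← neg_sub]
      exact neg_mem hts
    have ht' : homogeneousComponent d t ∈ Submodule.span R (Set.range b) := by
      clear hts hst
      induction ht using Submodule.span_induction with
      | mem x hx =>
        obtain ⟨i, rfl⟩ := hx
        rw [homogeneousComponent_of_mem (isHomogeneous_monomial 1 rfl)]
        split_ifs
        · exact Submodule.subset_span ⟨i, rfl⟩
        · exact zero_mem _
      | zero => rw [map_zero]; exact zero_mem _
      | add x y _ _ hx hy => rw [map_add]; exact add_mem hx hy
      | smul a x _ hx => rw [map_smul]; exact Submodule.smul_of_tower_mem _ a hx
    have hsub : homogeneousComponent d (s - t) ∈ Submodule.span R (Set.range b) := by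
      clear hts
      obtain ⟨a, ha⟩ := (Ideal.mem_span_range_iff_exists_fun).1 hst
      rw [← ha, map_sum]
      refine sum_mem fun j _ => ?_
      obtain ⟨e, he⟩ := hf j
      rcases lt_or_ge d e with hde | hde
      · rw [homogeneousComponent_mul_of_lt he _ hde]
        exact zero_mem _
      · obtain ⟨c, rfl⟩ := Nat.exists_eq_add_of_le' hde
        rw [homogeneousComponent_add_mul he]
        rcases Nat.eq_zero_or_pos e with rfl | hpos
        · have : f j = 0 := by
            rw [← totalDegree_zero_iff_isHomogeneous, totalDegree_eq_zero_iff_eq_C] at he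
            rw [he, show coeff 0 (f j) = 0 from hf0 j, C_0]
          rw [this, mul_zero]
          exact zero_mem _
        · rw [mul_comm]
          exact Submodule.smul_mem _ (⟨f j, Algebra.subset_adjoin ⟨j, rfl⟩⟩ : R)
            (ih c (by omega) _ (homogeneousComponent_isHomogeneous c _))
    have := add_mem hsub ht'
    rwa [← map_add, sub_add_cancel, homogeneousComponent_of_mem hs, if_pos rfl] at this
  refine ⟨B, Module.Basis.mk hLI fun s _ => ?_, hB0 rfl, fun i => ?_⟩
  · exact mem_of_homogeneousComponent_mem fun d => hT d _ (homogeneousComponent_isHomogeneous d s)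
  · rw [Module.Basis.mk_apply]

/-- The coordinate at the basis monomial `1` is a retraction. It is graded because the basis and the
algebra are: in the expansion of a form, each coordinate may be replaced by its component of
complementary degree, and expansions are unique. -/
theorem exists_graded_retraction {f : Fin n → MvPolynomial (Fin n) k}
    (hf : ∀ i, ∃ d, (f i).IsHomogeneous d) (hf0 : ∀ i, constantCoeff (f i) = 0)
    (hpow : ∀ i, ∃ N, X i ^ N ∈ Ideal.span (Set.range f)) :
    ∃ π : MvPolynomial (Fin n) k →ₗ[Algebra.adjoin k (Set.range f)]
        Algebra.adjoin k (Set.range f),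
      π 1 = 1 ∧ ∀ d s, s.IsHomogeneous d → (π s : MvPolynomial (Fin n) k).IsHomogeneous d := by
  classical
  obtain ⟨B, b, hB0, hb⟩ := exists_basis_monomial hf hf0 hpow
  have hgr : IsGraded (Algebra.adjoin k (Set.range f)) := isGraded_adjoin (by
    rintro _ ⟨i, rfl⟩
    exact hf i)
  refine ⟨b.coord ⟨0, hB0⟩, ?_, fun d s hs => ?_⟩
  · have : (1 : MvPolynomial (Fin n) k) = b ⟨0, hB0⟩ := (hb ⟨0, hB0⟩).symm
    rw [this, Module.Basis.coord_apply, Module.Basis.repr_self, Finsupp.single_eq_same]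
  · let r : B → Algebra.adjoin k (Set.range f) := fun i => if i.1.degree ≤ d then
      ⟨homogeneousComponent (d - i.1.degree) (b.repr s i : MvPolynomial (Fin n) k),
        hgr _ (b.repr s i).2 _⟩ else 0
    have hr : ∑ i ∈ (b.repr s).support, r i • b i = s := by
      conv_rhs => rw [← if_pos (rfl : d = d) (t := s) (e := 0), ← homogeneousComponent_of_mem hs,
        ← b.linearCombination_repr s, Finsupp.linearCombination_apply, Finsupp.sum, map_sum]
      refine Finset.sum_congr rfl fun i _ => ?_
      have hbi : (b i).IsHomogeneous i.1.degree := by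
        rw [hb]
        exact isHomogeneous_monomial 1 rfl
      change (r i : MvPolynomial (Fin n) k) * b i =
        homogeneousComponent d ((b.repr s i : MvPolynomial (Fin n) k) * b i)
      by_cases hi : i.1.degree ≤ d
      · obtain ⟨e, rfl⟩ := Nat.exists_eq_add_of_le' hi
        rw [homogeneousComponent_add_mul hbi]
        simp only [r, if_pos hi, Nat.add_sub_cancel]
      · rw [homogeneousComponent_mul_of_lt hbi _ (not_le.1 hi)]
        simp only [r, if_neg hi]
        exact zero_mul _
    have h0 : b.repr s ⟨0, hB0⟩ = r ⟨0, hB0⟩ := by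
      by_cases h : (⟨0, hB0⟩ : B) ∈ (b.repr s).support
      · conv_lhs => rw [← hr, map_sum, Finsupp.finsetSum_apply]
        rw [Finset.sum_eq_single_of_mem _ h]
        · simp
        · intro i _ hi
          simp [hi]
      · rw [Finsupp.notMem_support_iff] at h
        have h' : (homogeneousComponent (d - Finsupp.degree (0 : Fin n →₀ ℕ)))
            (0 : MvPolynomial (Fin n) k) = 0 := map_zero _
        refine Subtype.ext ?_
        simp only [r, h, map_zero, zero_le, if_true]
        exact h'.symm
    rw [Module.Basis.coord_apply, h0]
    simp only [r, map_zero, zero_le, if_true, Nat.sub_zero]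
    exact homogeneousComponent_isHomogeneous _ _

end Retraction

end MvPolynomial

namespace AbelianCoregular

/-! ### Orbit vectors and the algebra they span -/

section Orbit

variable {k S Γ : Type*} [Field k] [CommRing S] [Algebra k S] [Group Γ]

/-- The values of an element under all members of a group acting on the ring. -/
noncomputable def orbitMap (Φ : Γ →* (S →ₐ[k] S)) : S →+* (Γ → S) :=
  RingHom.pi fun g => (Φ g : S →+* S)

theorem orbitMap_apply (Φ : Γ →* (S →ₐ[k] S)) (s : S) (g : Γ) : orbitMap Φ s g = Φ g s := rfl

variable {Φ : Γ →* (S →ₐ[k] S)} {R : Subalgebra k S}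

/-- The orbit vectors of a basis over the invariants are linearly independent over the whole
ring. -/
theorem linearIndependent_orbitMap [Finite Γ] [IsDomain S] (hΦ : Function.Injective Φ)
    (hR : ∀ f, f ∈ R ↔ ∀ g, Φ g f = f) {ι : Type*} (b : Module.Basis ι R S) :
    LinearIndependent S fun i => orbitMap Φ (b i) := by
  classical
  have := Fintype.ofFinite Γ
  rw [linearIndependent_iff']
  intro s c hc i hi
  have h1 : ∀ (h : Γ), ∑ i ∈ s, Φ h (c i) * b i = 0 := by
    intro h
    have h2 := congrArg (Φ h) (congrFun hc h⁻¹)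
    simp only [Finset.sum_apply, Pi.smul_apply, orbitMap_apply, Pi.zero_apply, map_zero, map_sum,
      smul_eq_mul, map_mul] at h2
    rw [← h2]
    refine Finset.sum_congr rfl fun i _ => ?_
    rw [← AlgHom.mul_apply, ← map_mul, mul_inv_cancel, map_one, AlgHom.one_apply]
  have hmem : ∀ x, ∑ h, Φ h x ∈ R := by
    intro x
    rw [hR]
    intro g
    rw [map_sum]
    refine Fintype.sum_equiv (Equiv.mulLeft g) _ _ fun h => ?_
    rw [Equiv.coe_mulLeft, map_mul, AlgHom.mul_apply]
  -- Multiplying the relations in `h1` by `Φ h x` and summing over `h` makes the coefficients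
  -- invariant, so independence over `R` applies. As `x` is arbitrary, Dedekind's independence of
  -- characters then kills `c i`.
  have h2 : ∀ x, ∑ h, Φ h (x * c i) = 0 := by
    intro x
    have h3 : ∑ j ∈ s, (⟨∑ h, Φ h (x * c j), hmem _⟩ : R) • b j = 0 := by
      change ∑ j ∈ s, (∑ h, Φ h (x * c j)) * b j = 0
      simp_rw [Finset.sum_mul]
      rw [Finset.sum_comm]
      refine Finset.sum_eq_zero fun h _ => ?_
      simp_rw [map_mul, mul_assoc]
      rw [← Finset.mul_sum, h1, mul_zero]
    exact congrArg Subtype.val (linearIndependent_iff'.1 b.linearIndependent s _ h3 i hi)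
  have hinj : Function.Injective fun h : Γ => ((Φ h : S →ₐ[k] S) : S →* S) := by
    intro g h hgh
    exact hΦ (AlgHom.ext fun x => DFunLike.congr_fun hgh x)
  have h4 := (linearIndependent_monoidHom S S).comp _ hinj
  have h5 := Fintype.linearIndependent_iff.1 h4 (fun h => Φ h (c i)) (by
    ext x
    have := h2 x
    simp only [Finset.sum_apply, Pi.smul_apply, smul_eq_mul, Pi.zero_apply]
    rw [← this]
    refine Finset.sum_congr rfl fun h _ => ?_
    rw [map_mul, mul_comm]
    rfl) 1
  rwa [map_one, AlgHom.one_apply] at h5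

/-- Orbit vectors are closed under multiplication, so their `S`-algebra is their `S`-span; invariant
coefficients come out of an orbit vector as scalars, leaving those of the basis. -/
theorem exists_finsupp_of_mem_adjoin (hR : ∀ f, f ∈ R ↔ ∀ g, Φ g f = f) {ι : Type*}
    (b : Module.Basis ι R S) {w : Γ → S}
    (hw : w ∈ Algebra.adjoin S (Set.range (orbitMap Φ))) :
    ∃ c : ι →₀ S, c.sum (fun i a => a • orbitMap Φ (b i)) = w := by
  rw [← Finsupp.mem_span_range_iff_exists_finsupp]
  have h1 : w ∈ Submodule.span S (Set.range (orbitMap Φ)) := by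
    have h2 : w ∈ Subalgebra.toSubmodule (Algebra.adjoin S (Set.range (orbitMap Φ))) := hw
    rw [Algebra.adjoin_eq_span] at h2
    have h3 : Set.range (orbitMap Φ) = MonoidHom.mrange (orbitMap Φ : S →* (Γ → S)) := rfl
    rwa [h3, Submonoid.closure_eq, ← h3] at h2
  refine Submodule.span_le.2 ?_ h1
  rintro _ ⟨s, rfl⟩
  rw [SetLike.mem_coe, ← b.linearCombination_repr s, Finsupp.linearCombination_apply,
    Finsupp.sum, map_sum]
  refine sum_mem fun i _ => ?_
  have : orbitMap Φ (b.repr s i • b i) = (b.repr s i : S) • orbitMap Φ (b i) := by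
    ext g
    rw [orbitMap_apply, Pi.smul_apply, orbitMap_apply, smul_eq_mul, Subalgebra.smul_def,
      smul_eq_mul, map_mul, (hR _).1 (b.repr s i).2]
  rw [this]
  exact Submodule.smul_mem _ _ (Submodule.subset_span ⟨i, rfl⟩)

/-- A function on the group which is locally, at every prime of the ring, a combination of orbit
vectors is one globally. -/
theorem mem_adjoin_of_forall_prime [Finite Γ] [IsDomain S] [UniqueFactorizationMonoid S]
    (hΦ : Function.Injective Φ) (hR : ∀ f, f ∈ R ↔ ∀ g, Φ g f = f) {ι : Type*}
    (b : Module.Basis ι R S) {e : Γ → S} {a : S} (ha : a ≠ 0)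
    (hae : a • e ∈ Algebra.adjoin S (Set.range (orbitMap Φ)))
    (he : ∀ p : S, Prime p → ∃ t, ¬ p ∣ t ∧ t • e ∈ Algebra.adjoin S (Set.range (orbitMap Φ))) :
    e ∈ Algebra.adjoin S (Set.range (orbitMap Φ)) := by
  have hli := linearIndependent_orbitMap hΦ hR b
  revert ha hae
  induction a using UniqueFactorizationMonoid.induction_on_prime with
  | h₁ => intro h; exact absurd rfl h
  | h₂ u hu =>
    intro _ hue
    obtain ⟨v, hv⟩ := hu.exists_left_inv
    have := Subalgebra.smul_mem _ hue v
    rwa [smul_smul, hv, one_smul] at this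
  | h₃ s p hs hp ih =>
    intro _ hps
    refine ih hs ?_
    obtain ⟨t, hpt, ht⟩ := he p hp
    obtain ⟨c, hc⟩ := exists_finsupp_of_mem_adjoin hR b hps
    obtain ⟨d, hd⟩ := exists_finsupp_of_mem_adjoin hR b ht
    -- Both sides are coordinates of `(t * p * s) • e`. As `p` does not divide `t`, it divides every
    -- `c i` and can be cancelled.
    have hcd : t • c = (p * s) • d := by
      refine hli ?_
      rw [map_smul, map_smul, Finsupp.linearCombination_apply, Finsupp.linearCombination_apply,
        hc, hd, smul_comm]
    have hdvd : ∀ i, p ∣ c i := by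
      intro i
      have h := DFunLike.congr_fun hcd i
      simp only [Finsupp.smul_apply, smul_eq_mul] at h
      refine (hp.dvd_or_dvd ?_).resolve_left hpt
      rw [h, mul_assoc]
      exact dvd_mul_right _ _
    choose q hq using hdvd
    have hse : s • e = ∑ i ∈ c.support, q i • orbitMap Φ (b i) := by
      ext g
      refine mul_left_cancel₀ hp.ne_zero ?_
      have h := congrFun hc g
      rw [Finsupp.sum, Finset.sum_apply] at h
      rw [Pi.smul_apply, smul_eq_mul, ← mul_assoc, Finset.sum_apply, Finset.mul_sum]
      refine h.symm.trans (Finset.sum_congr rfl fun i _ => ?_)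
      rw [Pi.smul_apply, Pi.smul_apply, smul_eq_mul, smul_eq_mul, ← mul_assoc, ← hq]
    rw [hse]
    exact sum_mem fun i _ => Subalgebra.smul_mem _ (Algebra.subset_adjoin (Set.mem_range_self _)) _

/-- If the members of a subgroup can be separated from its complement modulo a prime, then the
indicator function of the subgroup is a combination of orbit vectors at that prime. -/
theorem exists_smul_indicator_mem_adjoin [Finite Γ] (H : Subgroup Γ) {p : S} (hp : Prime p)
    (hsep : ∀ h ∈ H, ∀ g ∉ H, ∃ x, ¬ p ∣ Φ g x - Φ h x) :
    ∃ t, ¬ p ∣ t ∧ t • (H : Set Γ).indicator 1 ∈ Algebra.adjoin S (Set.range (orbitMap Φ)) := by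
  classical
  have := Fintype.ofFinite Γ
  have hsep' : ∀ g : {g // g ∉ H}, ∀ h : H, ∃ x, ¬ p ∣ Φ g x - Φ h x :=
    fun g h => hsep h h.2 g g.2
  choose x hx using hsep'
  let A := Algebra.adjoin S (Set.range (orbitMap Φ))
  let w : {g // g ∉ H} → Γ → S := fun g =>
    ∏ h : H, (orbitMap Φ (x g h) - algebraMap S (Γ → S) (Φ h (x g h)))
  have hwA : ∀ g, w g ∈ A := fun g => prod_mem fun h _ =>
    sub_mem (Algebra.subset_adjoin ⟨_, rfl⟩) (A.algebraMap_mem _)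
  have hw : ∀ g γ, w g γ = ∏ h : H, (Φ γ (x g h) - Φ h (x g h)) := fun g γ => by
    simp only [w, Finset.prod_apply]
    rfl
  -- Each `w g` vanishes on `H`, and `p` does not divide its value at `g`. So the product of the `w
  -- g g - w g` is this constant on `H` and zero off `H`.
  refine ⟨∏ g, w g g, ?_, ?_⟩
  · rw [hp.dvd_finsetProd_iff]
    rintro ⟨g, -, hg⟩
    rw [hw, hp.dvd_finsetProd_iff] at hg
    obtain ⟨h, -, hh⟩ := hg
    exact hx g h hh
  · have : (∏ g, w g g) • (H : Set Γ).indicator (1 : Γ → S) =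
        ∏ g : {g // g ∉ H}, (algebraMap S (Γ → S) (w g g) - w g) := by
      ext γ
      rw [Pi.smul_apply, Finset.prod_apply, smul_eq_mul]
      by_cases hγ : γ ∈ H
      · rw [Set.indicator_of_mem hγ, Pi.one_apply, mul_one]
        refine Finset.prod_congr rfl fun g _ => ?_
        have : w g γ = 0 := by
          rw [hw]
          exact Finset.prod_eq_zero (Finset.mem_univ ⟨γ, hγ⟩) (sub_self _)
        rw [Pi.sub_apply, this, sub_zero]
        rfl
      · rw [Set.indicator_of_notMem hγ, mul_zero]
        exact (Finset.prod_eq_zero (Finset.mem_univ ⟨γ, hγ⟩) (sub_self _)).symm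
    rw [this]
    exact prod_mem fun g _ => sub_mem (A.algebraMap_mem _) (hwA g)

end Orbit

end AbelianCoregular

namespace MvPolynomial

/-! ### Basic invariants are parameters -/

section Parameters

variable {k σ Γ : Type*} [Field k]

theorem constantCoeff_eq_zero_of_algebraicIndependent {ι : Type*} {f : ι → MvPolynomial σ k}
    (hf : ∀ i, ∃ d, (f i).IsHomogeneous d) (hai : AlgebraicIndependent k f) (i : ι) :
    constantCoeff (f i) = 0 := by
  obtain ⟨d, hd⟩ := hf i
  rcases Nat.eq_zero_or_pos d with rfl | hpos
  · rw [← totalDegree_zero_iff_isHomogeneous, totalDegree_eq_zero_iff_eq_C] at hd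
    exact absurd (hd ▸ isAlgebraic_algebraMap _ : IsAlgebraic k (f i)) (hai.transcendental i)
  · rw [constantCoeff_eq]
    refine hd.coeff_eq_zero ?_
    simpa using hpos.ne

theorem mem_span_of_mem_adjoin {s : Set (MvPolynomial σ k)} (hs : ∀ f ∈ s, constantCoeff f = 0)
    {r : MvPolynomial σ k} (hr : r ∈ Algebra.adjoin k s) (h0 : constantCoeff r = 0) :
    r ∈ Ideal.span s := by
  suffices h : r - C (constantCoeff r) ∈ Ideal.span s by rwa [h0, C_0, sub_zero] at h
  clear h0
  induction hr using Algebra.adjoin_induction with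
  | mem x hx =>
    rw [hs x hx, C_0, sub_zero]
    exact Ideal.subset_span hx
  | algebraMap a =>
    rw [algebraMap_eq, constantCoeff_C, sub_self]
    exact zero_mem _
  | add x y _ _ hx hy =>
    have h : x + y - C (constantCoeff (x + y)) =
        (x - C (constantCoeff x)) + (y - C (constantCoeff y)) := by
      rw [map_add, C_add]
      ring
    rw [h]
    exact add_mem hx hy
  | mul x y _ _ hx hy =>
    have h : x * y - C (constantCoeff (x * y)) =
        x * (y - C (constantCoeff y)) + C (constantCoeff y) * (x - C (constantCoeff x)) := by
      rw [map_mul, C_mul]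
      ring
    rw [h]
    exact add_mem (Ideal.mul_mem_left _ _ hy) (Ideal.mul_mem_left _ _ hx)

variable [Group Γ] {Φ : Γ →* (MvPolynomial σ k →ₐ[k] MvPolynomial σ k)}
  {R : Subalgebra k (MvPolynomial σ k)}

theorem constantCoeff_apply_of_linear (hlin : ∀ g i, (Φ g (X i)).IsHomogeneous 1) (g : Γ)
    (f : MvPolynomial σ k) : constantCoeff (Φ g f) = constantCoeff f := by
  induction f using MvPolynomial.induction_on with
  | C a => rw [← algebraMap_eq, AlgHom.commutes]
  | add p q hp hq => rw [map_add, map_add, hp, hq, map_add]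
  | mul_X p i hp =>
    rw [map_mul, map_mul, map_mul, constantCoeff_X, hp, constantCoeff_eq,
      (hlin g i).coeff_eq_zero (by simp)]

/-- If the invariants of a finite linear group are generated by elements without constant term,
then these generate an ideal containing a power of every variable. -/
theorem exists_X_pow_mem_span [Finite Γ] (hlin : ∀ g i, (Φ g (X i)).IsHomogeneous 1)
    (hR : ∀ f, f ∈ R ↔ ∀ g, Φ g f = f) {s : Set (MvPolynomial σ k)}
    (hs : ∀ f ∈ s, constantCoeff f = 0) (hadj : Algebra.adjoin k s = R) (i : σ) :
    ∃ N, X i ^ N ∈ Ideal.span s := by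
  have := Fintype.ofFinite Γ
  -- The orbit polynomial of `X i` has invariant coefficients. Taking constant terms turns it into a
  -- power of the variable, so its lower coefficients lie in the ideal, and `Q (X i) = 0` is the
  -- desired relation.
  let Q : Polynomial (MvPolynomial σ k) := ∏ g, (Polynomial.X - Polynomial.C (Φ g (X i)))
  have hmon : Q.Monic := Polynomial.monic_prod_of_monic _ _ fun g _ => Polynomial.monic_X_sub_C _
  have hdeg : Q.natDegree = Fintype.card Γ := by
    rw [Polynomial.natDegree_prod_of_monic _ _ fun g _ => Polynomial.monic_X_sub_C _]
    simp
  have hQR : ∀ j, Q.coeff j ∈ R := by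
    intro j
    rw [hR]
    intro h
    have h1 : Q.map (Φ h : MvPolynomial σ k →+* MvPolynomial σ k) = Q := by
      simp only [Q, Polynomial.map_prod, Polynomial.map_sub, Polynomial.map_X, Polynomial.map_C]
      refine Fintype.prod_equiv (Equiv.mulLeft h) _ _ fun g => ?_
      rw [Equiv.coe_mulLeft, map_mul]
      rfl
    conv_rhs => rw [← h1, Polynomial.coeff_map]
    rfl
  have hQ0 : ∀ j, j < Q.natDegree → constantCoeff (Q.coeff j) = 0 := by
    intro j hj
    have h1 : Q.map constantCoeff = Polynomial.X ^ Fintype.card Γ := by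
      simp only [Q, Polynomial.map_prod, Polynomial.map_sub, Polynomial.map_X, Polynomial.map_C,
        constantCoeff_apply_of_linear hlin, constantCoeff_X, map_zero, sub_zero]
      rw [Finset.prod_const, Finset.card_univ]
    rw [← Polynomial.coeff_map, h1, Polynomial.coeff_X_pow, if_neg]
    rw [← hdeg]
    exact hj.ne
  have heval : Q.eval (X i) = 0 := by
    rw [Polynomial.eval_prod]
    refine Finset.prod_eq_zero (Finset.mem_univ 1) ?_
    simp
  refine ⟨Q.natDegree, ?_⟩
  rw [Polynomial.eval_eq_sum_range, Finset.sum_range_succ, hmon.coeff_natDegree, one_mul] at heval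
  rw [eq_neg_of_add_eq_zero_right heval]
  refine neg_mem (sum_mem fun j hj => Ideal.mul_mem_right _ _ ?_)
  exact mem_span_of_mem_adjoin hs (hadj ▸ hQR j) (hQ0 j (Finset.mem_range.1 hj))

end Parameters

/-! ### Freeness forces generation by reflections -/

section Reflections

variable {k σ Γ : Type*} [Field k]

/-- A prime dividing a nonzero linear form has degree one, so every linear form it divides is a
scalar multiple of it. -/
theorem exists_C_mul_of_prime_dvd {ι : Type*} {p : MvPolynomial σ k} (hp : Prime p)
    {D : ι → MvPolynomial σ k} (hD : ∀ i, (D i).IsHomogeneous 1) (hdvd : ∀ i, p ∣ D i) {i₀ : ι}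
    (h0 : D i₀ ≠ 0) (j : ι) : ∃ c : k, D j = C c * D i₀ := by
  have hdeg : ∀ {q r : MvPolynomial σ k}, r.IsHomogeneous 1 → r ≠ 0 → r = p * q →
      p.totalDegree + q.totalDegree = 1 := by
    intro q r hr hr0 hrq
    rw [← totalDegree_mul_of_isDomain hp.ne_zero, ← hrq, hr.totalDegree hr0]
    rintro rfl
    exact hr0 (by rw [hrq, mul_zero])
  have hp1 : p.totalDegree ≠ 0 := by
    intro h
    rw [totalDegree_eq_zero_iff_eq_C] at h
    refine hp.not_isUnit ?_
    rw [h]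
    refine (IsUnit.mk0 _ ?_).map C
    intro hc
    exact hp.ne_zero (by rw [h, hc, C_0])
  have hq : ∀ i, ∃ c : k, D i = C c * p := by
    intro i
    by_cases hi : D i = 0
    · exact ⟨0, by rw [hi, C_0, zero_mul]⟩
    · obtain ⟨q, hq⟩ := hdvd i
      have h1 : q.totalDegree = 0 := by
        have := hdeg (hD i) hi hq
        omega
      rw [totalDegree_eq_zero_iff_eq_C] at h1
      exact ⟨coeff 0 q, by rw [← h1, hq, mul_comm]⟩
  obtain ⟨a, ha⟩ := hq i₀
  obtain ⟨c, hc⟩ := hq j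
  have ha0 : a ≠ 0 := by
    rintro rfl
    exact h0 (by rw [ha, C_0, zero_mul])
  exact ⟨c * a⁻¹, by rw [ha, hc, ← mul_assoc, ← C_mul, inv_mul_cancel_right₀ ha0]⟩

/-- A finite linear group over whose invariants the polynomial ring is free is generated by
pseudo-reflections. -/
theorem eq_top_of_reflection_mem [Finite σ] [Group Γ] [Finite Γ]
    {Φ : Γ →* (MvPolynomial σ k →ₐ[k] MvPolynomial σ k)} (hΦ : Function.Injective Φ)
    (hlin : ∀ g i, (Φ g (X i)).IsHomogeneous 1) {R : Subalgebra k (MvPolynomial σ k)}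
    (hR : ∀ f, f ∈ R ↔ ∀ g, Φ g f = f) {ι : Type*} (b : Module.Basis ι R (MvPolynomial σ k))
    (H : Subgroup Γ)
    (hH : ∀ τ i₀, (∀ i, ∃ c : k, Φ τ (X i) - X i = C c * (Φ τ (X i₀) - X i₀)) → τ ∈ H) :
    H = ⊤ := by
  classical
  have hΦX : ∀ {g h : Γ}, (∀ i, Φ g (X i) = Φ h (X i)) → g = h :=
    fun hgh => hΦ (algHom_ext hgh)
  have hsep : ∀ p : MvPolynomial σ k, Prime p → ∀ h ∈ H, ∀ g ∉ H, ∃ x, ¬ p ∣ Φ g x - Φ h x := by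
    intro p hp h hh g hg
    by_contra! hdvd
    obtain ⟨i₀, hi₀⟩ : ∃ i, Φ g (X i) - Φ h (X i) ≠ 0 := by
      by_contra! h0
      exact hg (hΦX (fun i => sub_eq_zero.1 (h0 i)) ▸ hh)
    refine hg ?_
    rw [← mul_inv_cancel_left h g]
    refine H.mul_mem hh (hH _ i₀ fun i => ?_)
    obtain ⟨c, hc⟩ := exists_C_mul_of_prime_dvd hp
      (fun i => (hlin g i).sub (hlin h i)) (fun i => hdvd (X i)) hi₀ i
    refine ⟨c, ?_⟩
    have h1 := congrArg (Φ h⁻¹) hc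
    have hinv : ∀ x, Φ h⁻¹ (Φ h x) = x := fun x => by
      rw [← AlgHom.mul_apply, ← map_mul, inv_mul_cancel, map_one, AlgHom.one_apply]
    rw [map_mul, map_sub, map_sub, hinv, hinv, ← algebraMap_eq, AlgHom.commutes,
      algebraMap_eq] at h1
    rw [map_mul]
    exact h1
  by_contra hne
  obtain ⟨g, hg⟩ : ∃ g, g ∉ H := by
    by_contra! h
    exact hne ((Subgroup.eq_top_iff' H).2 h)
  -- Only the existence of a variable matters: the prime `X i` supplies one nonzero multiple of the
  -- indicator in the span.
  obtain ⟨i, -⟩ : ∃ i : σ, Φ g (X i) ≠ X i := by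
    by_contra! h
    have hg1 : g = 1 := hΦX fun i => by rw [h, map_one, AlgHom.one_apply]
    exact hg (hg1 ▸ H.one_mem)
  have hloc : ∀ p : MvPolynomial σ k, Prime p → _ := fun p hp =>
    AbelianCoregular.exists_smul_indicator_mem_adjoin H hp (hsep p hp)
  obtain ⟨t, ht, hmem⟩ := hloc _ (X_prime (i := i))
  have ht0 : t ≠ 0 := by
    rintro rfl
    exact ht (dvd_zero _)
  have he := AbelianCoregular.mem_adjoin_of_forall_prime hΦ hR b ht0 hmem hloc
  obtain ⟨c, hc⟩ := AbelianCoregular.exists_finsupp_of_mem_adjoin hR b he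
  have hconst : ∀ γ, constantCoeff ((H : Set Γ).indicator (1 : Γ → MvPolynomial σ k) γ) =
      ∑ i ∈ c.support, constantCoeff (c i) * constantCoeff (b i) := by
    intro γ
    rw [← hc, Finsupp.sum, Finset.sum_apply, map_sum]
    refine Finset.sum_congr rfl fun i _ => ?_
    rw [Pi.smul_apply, smul_eq_mul, map_mul, AbelianCoregular.orbitMap_apply,
      constantCoeff_apply_of_linear hlin]
  have h1 := (hconst 1).trans (hconst g).symm
  rw [Set.indicator_of_mem (show (1 : Γ) ∈ (H : Set Γ) from H.one_mem),
    Set.indicator_of_notMem (show g ∉ (H : Set Γ) from hg), Pi.one_apply, map_one, map_zero] at h1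
  exact one_ne_zero h1

end Reflections

end MvPolynomial

namespace AbelianCoregular

/-! ### Coregularity implies both conditions -/

section Coregular

variable {k : Type*} [Field k] {V : Type*} [AddCommGroup V] [Module k V]

theorem polyAction_X_isHomogeneous {ι : Type*} (b : Module.Basis ι k (Module.Dual k V))
    (σ : V ≃ₗ[k] V) (i : ι) : (polyAction b σ (X i)).IsHomogeneous 1 := by
  rw [polyAction_X, Module.Basis.constr_apply]
  refine IsHomogeneous.sum _ _ _ fun j _ => ?_
  change (_ • X j).IsHomogeneous 1
  rw [smul_eq_C_mul]
  exact isHomogeneous_C_mul_X _ _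

theorem polyAction_injective {ι : Type*} (b : Module.Basis ι k (Module.Dual k V)) :
    Function.Injective (polyAction b) := by
  intro σ τ h
  refine LinearEquiv.symm_bijective.injective (LinearEquiv.ext fun v => ?_)
  rw [← sub_eq_zero, ← Module.forall_dual_apply_eq_zero_iff k]
  intro x
  have h1 : dualRep σ = dualRep τ := b.ext fun i => constr_X_injective b (by
    rw [← polyAction_X, ← polyAction_X, h])
  rw [map_sub, ← dualRep_apply_apply, ← dualRep_apply_apply, h1, sub_self]

theorem IsCoregular.isPseudoReflectionGroup_and_directSummandProperty [FiniteDimensional k V]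
    {G : Subgroup (V ≃ₗ[k] V)} [Finite G] (h : IsCoregular G) :
    IsPseudoReflectionGroup G ∧ DirectSummandProperty G := by
  let b := Module.finBasis k (Module.Dual k V)
  obtain ⟨f, hf, hai, hgen⟩ := (isCoregular_iff b G).1 h
  have hf0 := constantCoeff_eq_zero_of_algebraicIndependent hf hai
  let Φ := (polyAction b).comp G.subtype
  have hlin : ∀ g i, (Φ g (X i)).IsHomogeneous 1 := fun g i => polyAction_X_isHomogeneous b g i
  have hpow := exists_X_pow_mem_span hlin (mem_polyInvariants_iff b G)
    (Set.forall_mem_range.2 hf0) hgen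
  constructor
  · obtain ⟨B, β, -, -⟩ := exists_basis_monomial hf hf0 hpow
    refine isPseudoReflectionGroup_of_closure_eq_top ?_
    refine eq_top_of_reflection_mem (Φ := Φ) ((polyAction_injective b).comp G.subtype_injective)
      hlin (fun f => by rw [hgen]; exact mem_polyInvariants_iff b G f) β _ fun τ i₀ hτ => ?_
    by_cases hτ1 : τ = 1
    · rw [hτ1]
      exact one_mem _
    refine Subgroup.subset_closure (isPseudoReflection_of_dualRep
      (fun h => hτ1 (Subtype.ext h)) (dualRep (τ : V ≃ₗ[k] V) (b i₀) - b i₀) fun x => ?_)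
    have hX : ∀ i, Φ τ (X i) - X i = b.constr k X (dualRep (τ : V ≃ₗ[k] V) (b i) - b i) := by
      intro i
      rw [map_sub, b.constr_basis, ← polyAction_X]
      rfl
    -- Proportionality of the displacements of the basis forms puts all displacements on one line.
    have hle : LinearMap.range (dualRep (τ : V ≃ₗ[k] V) - LinearMap.id) ≤
        Submodule.span k {dualRep (τ : V ≃ₗ[k] V) (b i₀) - b i₀} := by
      rw [← Submodule.map_top, ← b.span_eq, Submodule.map_span, Submodule.span_le]
      rintro _ ⟨_, ⟨i, rfl⟩, rfl⟩
      obtain ⟨c, hc⟩ := hτ i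
      rw [hX, hX, ← smul_eq_C_mul, ← map_smul] at hc
      exact Submodule.mem_span_singleton.2 ⟨c, (constr_X_injective b hc).symm⟩
    obtain ⟨c, hc⟩ := Submodule.mem_span_singleton.1 (hle ⟨x, rfl⟩)
    refine ⟨c, ?_⟩
    rw [hc]
    simp
  · obtain ⟨π, hπ1, hπ⟩ := exists_graded_retraction hf hf0 hpow
    rw [directSummandProperty_iff b, ← hgen]
    refine ⟨(Subalgebra.val _).toAddMonoidHom.comp π.toAddMonoidHom, fun s => (π s).2,
      fun r hr s => ?_, hπ, congrArg Subtype.val hπ1⟩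
    exact congrArg Subtype.val (π.map_smul ⟨r, hr⟩ s)

end Coregular

end AbelianCoregular

theorem theorem1 {k : Type*} [Field k] {V : Type*} [AddCommGroup V] [Module k V]
    [FiniteDimensional k V] (G : Subgroup (V ≃ₗ[k] V)) [Finite G]
    (hG : ∀ σ ∈ G, ∀ τ ∈ G, σ * τ = τ * σ) :
    AbelianCoregular.IsCoregular G ↔
      AbelianCoregular.IsPseudoReflectionGroup G ∧ AbelianCoregular.DirectSummandProperty G :=
  ⟨AbelianCoregular.IsCoregular.isPseudoReflectionGroup_and_directSummandProperty,
    fun h => AbelianCoregular.isCoregular_of_isPseudoReflectionGroup hG h.1 h.2⟩
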